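/- Let $r\ge 3$ and $k\ge 4$ be fixed integers and let $\ell=\lfloor (k-1)/2\rfloor$. An $r$-graph $H$ on a finite vertex set $V$ is a family of $r$-element subsets (edges) of $V$; $|H|$ is its number of edges. The shadow $\partial H$ is the set of all $(r-1)$-element sets contained in some edge of $H$, and $H$ is $d$-full if every member of $\partial H$ is contained in at least $d$ edges of $H$. The $k$-cycle $C_k$ is the linear (loose) $k$-cycle: $k$ distinct edges $e_0,\dots,e_{k-1}$, indices modulo $k$, such that $|e_i\cap e_{i+1}|=1$ for all $i$, and $e_i\cap e_j=\emptyset$ whenever $i\ne j$ are not cyclically consecutive. The $k$-path $P_k$ is the linear (loose) $k$-path: $k$ distinct edges $e_0,\dots,e_{k-1}$ such that $|e_i\cap e_{i+1}|=1$ for $0\le i\le k-2$ and $e_i\cap e_j=\emptyset$ whenever $|i-j|\ge 2$. For an $r$-graph $F$, $\mathrm{ex}_r(n,F)$ denotes the maximum number of edges of an $r$-graph on $n$ vertices that does not contain $F$. (a) For every $\varepsilon>0$ there is $N=N(\varepsilon,r,k)$ such that for all $n\ge N$, every $n$-vertex $(\ell+1)$-full $r$-graph $H$ with $C_k\not\subset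 H$ or $P_k\not\subset H$ satisfies $|H|\le\varepsilon n^{r-1}$; that is, $|H|=o(n^{r-1})$. (b) As $n\to\infty$, \[ \mathrm{ex}_r(n,P_k)\sim \ell\binom{n}{r-1}\qquad\text{and}\qquad \mathrm{ex}_r(n,C_k)\sim \ell\binom{n}{r-1}. \] -/

import Mathlib

open scoped FinsetFamily Asymptotics

namespace UniformHypergraph

/-- An `r`-graph on the vertex set `V`: a family of `r`-element subsets of `V`. -/
def IsRGraph {V : Type*} (r : ℕ) (H : Finset (Finset V)) : Prop :=
  (H : Set (Finset V)).Sized r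

/-- The codegree of a vertex set `S`: the number of edges of `H` that contain `S`. -/
def codegree {V : Type*} [DecidableEq V] (H : Finset (Finset V)) (S : Finset V) : ℕ :=
  (H.filter fun e => S ⊆ e).card

/-- `H` is `d`-full if every sub-edge (member of the shadow `∂ H`) has codegree at least `d`. -/
def IsFull {V : Type*} [DecidableEq V] (d : ℕ) (H : Finset (Finset V)) : Prop :=
  ∀ S ∈ ∂ H, d ≤ codegree H S

/-- A Berge `k`-cycle: distinct edges `e₀, …, e₍ₖ₋₁₎`, indices modulo `k`, with distinct
representatives `vᵢ ∈ eᵢ₋₁ ∩ eᵢ`. -/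
structure IsBergeCycle {V : Type*} [DecidableEq V] (k : ℕ) (e : ZMod k → Finset V) : Prop where
  injective : Function.Injective e
  representatives : ∃ v : ZMod k → V, Function.Injective v ∧ ∀ i, v i ∈ e (i - 1) ∩ e i

/-- A minimal `k`-cycle: a Berge `k`-cycle in which two distinct edges meet exactly if they are
cyclically consecutive, and no vertex belongs to all edges. -/
structure IsMinimalCycle {V : Type*} [DecidableEq V] (k : ℕ) (e : ZMod k → Finset V) : Prop
    extends IsBergeCycle k e where
  inter_nonempty_iff : ∀ i j, i ≠ j → ((e i ∩ e j).Nonempty ↔ j = i + 1 ∨ i = j + 1)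
  no_common_vertex : ¬ ∃ x, ∀ i, x ∈ e i

/-- A linear `k`-cycle: a minimal `k`-cycle whose consecutive edges share exactly one vertex. -/
structure IsLinearCycle {V : Type*} [DecidableEq V] (k : ℕ) (e : ZMod k → Finset V) : Prop
    extends IsMinimalCycle k e where
  card_inter : ∀ i, (e i ∩ e (i + 1)).card = 1

/-- A linear `k`-path (a linear `(k + 1)`-cycle with one edge deleted): distinct edges
`e₀, …, e₍ₖ₋₁₎` such that consecutive edges share exactly one vertex, and non-consecutive edges
are disjoint. -/
structure IsLinearPath {V : Type*} [DecidableEq V] (k : ℕ) (e : Fin k → Finset V) : Prop where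
  injective : Function.Injective e
  card_inter : ∀ i j : Fin k, (j : ℕ) = i + 1 → (e i ∩ e j).card = 1
  disjoint : ∀ i j : Fin k, (i : ℕ) + 1 < j → Disjoint (e i) (e j)

/-- `C_k ⊆ H`: some edges of `H` form a linear `k`-cycle. -/
def ContainsCycle {V : Type*} [DecidableEq V] (k : ℕ) (H : Finset (Finset V)) : Prop :=
  ∃ e : ZMod k → Finset V, (∀ i, e i ∈ H) ∧ IsLinearCycle k e

/-- `P_k ⊆ H`: some edges of `H` form a linear `k`-path. -/
def ContainsPath {V : Type*} [DecidableEq V] (k : ℕ) (H : Finset (Finset V)) : Prop :=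
  ∃ e : Fin k → Finset V, (∀ i, e i ∈ H) ∧ IsLinearPath k e

open Classical in
/-- `ex_r(n, ·)`: the maximum number of edges of an `r`-graph on `n` vertices that does not
contain the forbidden configuration. -/
noncomputable def ex (r n : ℕ) (Contains : Finset (Finset (Fin n)) → Prop) : ℕ :=
  (Finset.univ.filter fun H : Finset (Finset (Fin n)) => IsRGraph r H ∧ ¬ Contains H).sup
    Finset.card

end UniformHypergraph

/-! Write `r = s + 1` and `l = ⌊(k - 1) / 2⌋`, so `k` is `2l + 1` or `2l + 2`. The core is
`IsFull.containsCycle_and_containsPath`: an `(l + 1)`-full hypergraph `H` with more than `ε n ^ s`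
edges contains both configurations. Part (a) is its contrapositive.

For a large constant `K`, repeatedly delete all edges through a sub-edge of codegree at most `K`. If
a `(K + 1)`-full family survives, cycles are built in it greedily (`IsFull.hasClosedWalk`).
Otherwise `|H| ≤ K |∂H|`, so the shadow is dense. Each ordered member `S` of the shadow has `l + 1`
distinct extensions `f 0 S, …, f l S` to edges. A dense family of `s`-tuples contains complete
`s`-partite boxes, and a union bound provides one in which extension vertices of different rows
coincide only for a structural reason (`exists_separated_box`). The reason is measured by `Spread`:
a function that is not spread relative to a coordinate set `J` is, on a dense subfamily, a function
of the coordinates in `J` alone. Passing to such subfamilies leaves four cases, each with explicit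
walks in the box: (1) all `l + 1` functions are constant; (2) `l` are constant and one depends on a
single coordinate; (3) some function is spread relative to every single coordinate; (4) two
nonconstant functions each depend on a single coordinate. A constant extension vertex can join two
edges of a walk, while spread functions give each edge its own new vertex.

For (b), deleting down to an `(l + 1)`-full subfamily loses at most `l |∂H| ≤ l * n.choose s` edges,
which with (a) is the upper bound. For the lower bound take the `r`-sets meeting a fixed `l`-set in
exactly one vertex: a vertex lies in at most two edges of a path or cycle, so at most `2l < k` edges
can be covered. -/

namespace UniformHypergraph

/-! ### Linear walks, and their translation into paths and cycles -/

/-- A linear walk from `u` to `w` with `n` edges in `G` whose edges cover exactly `U`; consecutive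
edges share exactly one vertex, and other pairs of edges are disjoint. -/
inductive LinearWalk {V : Type*} [DecidableEq V] (G : Set (Finset V)) :
    V → V → ℕ → Finset V → Prop
  | nil (u : V) : LinearWalk G u u 0 {u}
  | cons {u v w : V} {n : ℕ} {e U : Finset V} (he : e ∈ G) (hu : u ∈ e) (hv : v ∈ e) (huv : u ≠ v)
      (hU : ∀ x ∈ e, x ∈ U → x = v) (h : LinearWalk G v w n U) : LinearWalk G u w (n + 1) (e ∪ U)

section Walks

variable {V : Type*} [DecidableEq V] {G : Set (Finset V)} {u v w : V} {n m : ℕ}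
  {e U U' : Finset V}

theorem LinearWalk.left_mem (h : LinearWalk G u v n U) : u ∈ U := by
  cases h with
  | nil => simp
  | cons he hu hv huv hU h => exact Finset.mem_union_left _ hu

theorem LinearWalk.right_mem (h : LinearWalk G u v n U) : v ∈ U := by
  induction h with
  | nil => simp
  | cons he hu hv huv hU h ih => exact Finset.mem_union_right _ ih

theorem LinearWalk.single (he : e ∈ G) (hu : u ∈ e) (hv : v ∈ e) (huv : u ≠ v) :
    LinearWalk G u v 1 e := by
  have := LinearWalk.cons (U := {v}) he hu hv huv (by simp) (LinearWalk.nil v)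
  rwa [Finset.union_eq_left.2 (by simpa using hv)] at this

theorem LinearWalk.append (h : LinearWalk G u v n U) :
    ∀ {m : ℕ} {U' : Finset V}, LinearWalk G v w m U' → (∀ x ∈ U, x ∈ U' → x = v) →
      LinearWalk G u w (n + m) (U ∪ U') := by
  induction h with
  | nil a =>
    intro m U' h' _
    rw [Finset.union_eq_right.2 (by simpa using h'.left_mem), zero_add]
    exact h'
  | @cons a b c k e U he hu hv huv hU h ih =>
    intro m U' h' hUU'
    have h1 := ih h' fun x hx hx' => hUU' x (Finset.mem_union_right _ hx) hx'
    rw [Finset.union_assoc, Nat.add_right_comm]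
    refine LinearWalk.cons he hu hv huv (fun x hx hx' => ?_) h1
    rcases Finset.mem_union.1 hx' with hx' | hx'
    · exact hU x hx hx'
    · have := hUU' x (Finset.mem_union_left _ hx) hx'
      subst this
      exact hU x hx h.right_mem

theorem LinearWalk.snoc (h : LinearWalk G u v n U) (he : e ∈ G) (hv : v ∈ e) (hw : w ∈ e)
    (hvw : v ≠ w) (hU : ∀ x ∈ U, x ∈ e → x = v) : LinearWalk G u w (n + 1) (U ∪ e) :=
  h.append (LinearWalk.single he hv hw hvw) hU

/-- Injectivity is needed only on the set `S` where the edges live. The final vertex must be assumed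
in `S` because a walk without edges covers a vertex that lies in no edge. -/
theorem LinearWalk.map {T : Type*} [DecidableEq T] {G : Set (Finset T)} {H : Set (Finset V)}
    {φ : T → V} {S : Set T} (hφ : Set.InjOn φ S) (hS : ∀ E ∈ G, (E : Set T) ⊆ S)
    (hG : ∀ E ∈ G, E.image φ ∈ H) {u v : T} {n : ℕ} {U : Finset T} (h : LinearWalk G u v n U) :
    v ∈ S → (U : Set T) ⊆ S ∧ LinearWalk H (φ u) (φ v) n (U.image φ) := by
  induction h with
  | nil u =>
    intro hu
    refine ⟨by simpa using hu, ?_⟩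
    rw [Finset.image_singleton]
    exact LinearWalk.nil _
  | @cons a b c k e U he hu hv huv hU h ih =>
    intro hc
    obtain ⟨h1, h2⟩ := ih hc
    refine ⟨by rw [Finset.coe_union]; exact Set.union_subset (hS e he) h1, ?_⟩
    rw [Finset.image_union]
    refine LinearWalk.cons (hG e he) (Finset.mem_image_of_mem _ hu) (Finset.mem_image_of_mem _ hv)
      (fun hab => huv (hφ (hS e he hu) (hS e he hv) hab)) (fun x hx hx' => ?_) h2
    obtain ⟨y, hy, rfl⟩ := Finset.mem_image.1 hx
    obtain ⟨z, hz, hzy⟩ := Finset.mem_image.1 hx'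
    have := hφ (h1 hz) (hS e he hy) hzy
    subst this
    rw [hU z hy hz]

/-- `G` contains a linear walk with `n` edges. -/
def HasWalk (G : Set (Finset V)) (n : ℕ) : Prop :=
  ∃ u v U, LinearWalk G u v n U

/-- `G` contains a closed linear walk with `k` edges. -/
def HasClosedWalk (G : Set (Finset V)) (k : ℕ) : Prop :=
  ∃ u v n m U U', u ≠ v ∧ LinearWalk G u v n U ∧ LinearWalk G v u m U' ∧
    (∀ x ∈ U, x ∈ U' → x = u ∨ x = v) ∧ n + m = k

theorem HasWalk.of_succ (h : HasWalk G (n + 1)) : HasWalk G n := by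
  obtain ⟨u, v, U, h⟩ := h
  cases h with
  | cons he hu hv huv hU h => exact ⟨_, _, _, h⟩

theorem HasWalk.mono (h : HasWalk G m) (hnm : n ≤ m) : HasWalk G n := by
  induction hnm with
  | refl => exact h
  | step _ ih => exact ih h.of_succ

theorem HasWalk.map {T : Type*} [DecidableEq T] {G : Set (Finset T)} {H : Set (Finset V)}
    {φ : T → V} {S : Set T} (hφ : Set.InjOn φ S) (hS : ∀ E ∈ G, (E : Set T) ⊆ S)
    (hG : ∀ E ∈ G, E.image φ ∈ H) (h : HasWalk G (n + 1)) : HasWalk H (n + 1) := by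
  obtain ⟨u, v, U, h⟩ := h
  have hv : v ∈ S := by
    have key : ∀ {a b : T} {k : ℕ} {W : Finset T}, LinearWalk G a b k W → a ∈ S → b ∈ S := by
      intro a b k W hW
      induction hW with
      | nil => exact id
      | cons he hu hv huv hU h ih => exact fun _ => ih (hS _ he hv)
    cases h with
    | cons he hu hv huv hU h => exact key h (hS _ he hv)
  exact ⟨_, _, _, (h.map hφ hS hG hv).2⟩

theorem HasClosedWalk.map {T : Type*} [DecidableEq T] {G : Set (Finset T)} {H : Set (Finset V)}
    {φ : T → V} {S : Set T} (hφ : Set.InjOn φ S) (hS : ∀ E ∈ G, (E : Set T) ⊆ S)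
    (hG : ∀ E ∈ G, E.image φ ∈ H) (h : HasClosedWalk G n) : HasClosedWalk H n := by
  obtain ⟨u, v, a, b, U, U', huv, h, h', hUU', hab⟩ := h
  have hu : u ∈ S := by
    cases h with
    | nil => exact absurd rfl huv
    | cons he hu _ _ _ _ => exact hS _ he hu
  have hv : v ∈ S := by
    cases h' with
    | nil => exact absurd rfl huv
    | cons he hu _ _ _ _ => exact hS _ he hu
  obtain ⟨h1, h2⟩ := h.map hφ hS hG hv
  obtain ⟨h3, h4⟩ := h'.map hφ hS hG hu
  refine ⟨_, _, a, b, _, _, fun hc => huv (hφ hu hv hc), h2, h4, fun x hx hx' => ?_, hab⟩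
  obtain ⟨y, hy, rfl⟩ := Finset.mem_image.1 hx
  obtain ⟨z, hz, hzy⟩ := Finset.mem_image.1 hx'
  have := hφ (h3 hz) (h1 hy) hzy
  subst this
  rcases hUU' z hy hz with rfl | rfl <;> simp

/-- Edges are moved one at a time from the front of the second walk to the end of the first, until a
single edge remains to close it. -/
theorem HasClosedWalk.exists_closing_edge (h : HasClosedWalk G (n + 1)) :
    ∃ u v U e, u ≠ v ∧ LinearWalk G u v n U ∧ e ∈ G ∧ u ∈ e ∧ v ∈ e ∧
      ∀ x ∈ U, x ∈ e → x = u ∨ x = v := by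
  obtain ⟨u, v, a, b, U, U', huv, h, h', hUU', hab⟩ := h
  induction b generalizing v a U U' with
  | zero =>
    cases h' with
    | nil => exact absurd rfl huv
  | succ b ih =>
    cases h' with
    | @cons _ v' _ _ e U'' he hv hv' hvv' hU h' =>
      by_cases hb : b = 0
      · subst hb
        cases h' with
        | nil =>
          obtain rfl : a = n := by omega
          exact ⟨u, v, U, e, huv, h, he, hv', hv,
            fun x hx hx' => hUU' x hx (Finset.mem_union_left _ hx')⟩
      · have huv' : u ≠ v' := by
          rintro rfl
          cases h' with
          | nil => exact hb rfl
          | cons he' hu'' hw huw hU' h'' =>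
            exact huw (hU' _ hu'' h''.right_mem)
        have hvU : v ∉ U'' := fun hvU => hvv' (hU v hv hvU)
        refine ih v' (a + 1) (U ∪ e) U'' huv' (h.snoc he hv hv' hvv' ?_) h' ?_ (by omega)
        · intro x hx hx'
          rcases hUU' x hx (Finset.mem_union_left _ hx') with rfl | rfl
          · exact absurd (hU _ hx' h'.right_mem) huv'
          · rfl
        · intro x hx hx'
          rcases Finset.mem_union.1 hx with hx | hx
          · rcases hUU' x hx (Finset.mem_union_right _ hx') with rfl | rfl
            · exact Or.inl rfl
            · exact absurd hx' hvU
          · exact Or.inr (hU x hx hx')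

/-- The last two clauses locate the endpoints: they carry the induction across a new first edge and
later control where a closing edge meets the walk. -/
theorem LinearWalk.exists_sequence (h : LinearWalk G u w n U) :
    ∃ (e : ℕ → Finset V) (c : ℕ → V), c 0 = u ∧ c n = w ∧
      (∀ i < n, e i ∈ G ∧ c i ∈ e i ∧ c (i + 1) ∈ e i ∧ e i ⊆ U) ∧ (∀ i ≤ n, c i ∈ U) ∧
      (∀ i ≤ n, ∀ j ≤ n, c i = c j → i = j) ∧
      (∀ i j, i < j → j < n → ∀ x ∈ e i, x ∈ e j → j = i + 1 ∧ x = c j) ∧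
      (∀ i < n, u ∈ e i → i = 0) ∧ (∀ i < n, w ∈ e i → i + 1 = n) := by
  induction h with
  | nil u => exact ⟨fun _ => ∅, fun _ => u, by simp⟩
  | @cons u v w n e₀ U he hu hv huv hU h ih =>
    obtain ⟨e, c, hc0, hcn, h1, h2, h3, h4, h5, h6⟩ := ih
    have huU : u ∉ U := fun huU => huv (hU u hu huU)
    refine ⟨fun i => Nat.casesOn i e₀ e, fun i => Nat.casesOn i u c, rfl, hcn, ?_, ?_, ?_, ?_,
      ?_, ?_⟩
    · rintro (_ | i) hi
      · exact ⟨he, hu, by simpa [hc0] using hv, Finset.subset_union_left⟩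
      · obtain ⟨a1, a2, a3, a4⟩ := h1 i (by omega)
        exact ⟨a1, a2, a3, a4.trans Finset.subset_union_right⟩
    · rintro (_ | i) hi
      · exact Finset.mem_union_left _ hu
      · exact Finset.mem_union_right _ (h2 i (by omega))
    · rintro (_ | i) hi (_ | j) hj hij
      · rfl
      · have hij : u = c j := hij
        exact absurd (hij ▸ h2 j (by omega)) huU
      · have hij : c i = u := hij
        exact absurd (hij ▸ h2 i (by omega)) huU
      · rw [h3 i (by omega) j (by omega) hij]
    · rintro (_ | i) (_ | j) hij hj x hx hx'
      · omega
      · have hxv := hU x hx ((h1 j (by omega)).2.2.2 hx')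
        subst hxv
        have := h5 j (by omega) hx'
        subst this
        exact ⟨rfl, hc0.symm⟩
      · omega
      · obtain ⟨a1, a2⟩ := h4 i j (by omega) (by omega) x hx hx'
        exact ⟨by omega, a2⟩
    · rintro (_ | i) hi hx
      · rfl
      · exact absurd ((h1 i (by omega)).2.2.2 hx) huU
    · rintro (_ | i) hi hx
      · have hwv := hU w hx h.right_mem
        cases h with
        | nil => rfl
        | cons he' hu' hv' huv' hU' h' =>
          subst hwv
          exact absurd (hU' _ hu' h'.right_mem) huv'
      · have := h6 i (by omega) hx
        omega

theorem containsPath_of_hasWalk {H : Finset (Finset V)} {k : ℕ} (h : HasWalk (H : Set (Finset V)) k) :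
    ContainsPath k H := by
  obtain ⟨u, v, U, h⟩ := h
  obtain ⟨e, c, hc0, hcn, h1, h2, h3, h4, h5, h6⟩ := h.exists_sequence
  refine ⟨fun i => e i, fun i => (h1 i i.2).1, ?_, ?_, ?_⟩
  · have key : ∀ i j : Fin k, i < j → e i ≠ e j := by
      intro i j hij heq
      have hij' : (i : ℕ) < j := hij
      obtain ⟨_, a2, a3, _⟩ := h1 i i.2
      have b1 := (h4 i j hij j.2 _ a2 (heq ▸ a2)).2
      have := h3 i i.2.le j j.2.le b1
      omega
    intro i j hij
    rcases lt_trichotomy i j with hlt | rfl | hlt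
    · exact absurd hij (key i j hlt)
    · rfl
    · exact absurd hij.symm (key j i hlt)
  · intro i j hij
    refine Finset.card_eq_one.2 ⟨c j, ?_⟩
    ext x
    simp only [Finset.mem_inter, Finset.mem_singleton]
    constructor
    · rintro ⟨hx, hx'⟩
      exact (h4 i j (by omega) j.2 x hx hx').2
    · rintro rfl
      have := (h1 i i.2).2.2.1
      rw [← hij] at this
      exact ⟨this, (h1 j j.2).2.1⟩
  · intro i j hij
    refine Finset.disjoint_left.2 fun x hx hx' => ?_
    have := (h4 i j (by omega) j.2 x hx hx').1
    omega

theorem containsCycle_of_sequence {H : Finset (Finset V)} {n : ℕ} (hn : 3 ≤ n)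
    (E : ℕ → Finset V) (c : ℕ → V) (hE : ∀ i ≤ n, E i ∈ H) (hc : ∀ i ≤ n, c i ∈ E i)
    (hc' : ∀ i < n, c (i + 1) ∈ E i) (hc0 : c 0 ∈ E n)
    (hinj : ∀ i ≤ n, ∀ j ≤ n, c i = c j → i = j)
    (hint : ∀ i j, i < j → j ≤ n → ∀ x ∈ E i, x ∈ E j →
      (j = i + 1 ∧ x = c j) ∨ (i = 0 ∧ j = n ∧ x = c 0)) : ContainsCycle (n + 1) H := by
  have hle : ∀ i : ZMod (n + 1), i.val ≤ n := fun i => Nat.lt_succ_iff.1 (ZMod.val_lt i)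
  have hone : (1 : ZMod (n + 1)).val = 1 := by
    rw [ZMod.val_one_eq_one_mod, Nat.mod_eq_of_lt (by omega)]
  have hsucc : ∀ i : ZMod (n + 1), i.val < n → (i + 1).val = i.val + 1 := by
    intro i hi
    rw [ZMod.val_add, hone, Nat.mod_eq_of_lt (by omega)]
  have hlast : ∀ i : ZMod (n + 1), i.val = n → (i + 1).val = 0 := by
    intro i hi
    rw [ZMod.val_add, hone, hi, Nat.mod_self]
  have hsuccmem : ∀ i : ZMod (n + 1), c (i + 1).val ∈ E i.val := by
    intro i
    rcases (hle i).lt_or_eq with hi | hi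
    · rw [hsucc i hi]; exact hc' _ hi
    · rw [hlast i hi, hi]; exact hc0
  have hcyc : ∀ i j : ZMod (n + 1), i ≠ j → ∀ x ∈ E i.val, x ∈ E j.val →
      (j = i + 1 ∧ x = c j.val) ∨ (i = j + 1 ∧ x = c i.val) := by
    have key : ∀ i j : ZMod (n + 1), i.val < j.val → ∀ x ∈ E i.val, x ∈ E j.val →
      (j = i + 1 ∧ x = c j.val) ∨ (i = j + 1 ∧ x = c i.val) := by
      intro i j hij x hx hx'
      rcases hint _ _ hij (hle j) x hx hx' with ⟨a, b⟩ | ⟨a, b, d⟩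
      · left
        refine ⟨ZMod.val_injective _ ?_, b⟩
        rw [hsucc i (by have := hle j; omega), a]
      · right
        refine ⟨ZMod.val_injective _ ?_, by rw [a, d]⟩
        rw [hlast j b, a]
    intro i j hij x hx hx'
    rcases lt_trichotomy i.val j.val with hlt | heq | hlt
    · exact key i j hlt x hx hx'
    · exact absurd (ZMod.val_injective _ heq) hij
    · exact (key j i hlt x hx' hx).symm
  have hadd1 : ∀ i : ZMod (n + 1), i + 1 ≠ i := by
    intro i h
    have := congrArg ZMod.val h
    rcases (hle i).lt_or_eq with hi | hi
    · rw [hsucc i hi] at this; omega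
    · rw [hlast i hi] at this; omega
  have hcinj : ∀ i j : ZMod (n + 1), c i.val = c j.val → i = j := fun i j h =>
    ZMod.val_injective _ (hinj _ (hle i) _ (hle j) h)
  refine ⟨fun i => E i.val, fun i => hE _ (hle i), ⟨⟨⟨?_, fun i => c i.val, fun i j h => hcinj i j h,
    ?_⟩, ?_, ?_⟩, ?_⟩⟩
  · intro i j hij
    by_contra hne
    have hij : E i.val = E j.val := hij
    -- If two edges were equal, the connecting vertices of both would lie in their intersection.
    -- Each either violates injectivity of `c` or fixes the cyclic order; what survives is `i + 2 =
    -- i`, impossible for `n + 1 ≥ 4`.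
    have a1 := hcyc i j hne _ (hc _ (hle i)) (hij ▸ hc _ (hle i))
    have a2 := hcyc i j hne _ (hsuccmem i) (hij ▸ hsuccmem i)
    have a3 := hcyc i j hne _ (hij ▸ hc _ (hle j)) (hc _ (hle j))
    have a4 := hcyc i j hne _ (hij ▸ hsuccmem j) (hsuccmem j)
    have := hadd1 i
    have := hadd1 j
    rcases a1 with ⟨b1, b2⟩ | ⟨b1, b2⟩
    · exact hne (hcinj _ _ b2)
    · rcases a4 with ⟨d1, d2⟩ | ⟨d1, d2⟩
      · have := hcinj _ _ d2; exact hadd1 j this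
      · rcases a2 with ⟨f1, f2⟩ | ⟨f1, f2⟩
        · rcases a3 with ⟨g1, g2⟩ | ⟨g1, g2⟩
          · have h3 : i + 1 + 1 = i := by rw [← f1, ← b1]
            have h4 := congrArg ZMod.val h3
            rcases (hle i).lt_or_eq with hi | hi
            · rcases (hle (i + 1)).lt_or_eq with hi' | hi'
              · rw [hsucc _ hi', hsucc _ hi] at h4; omega
              · rw [hlast _ hi'] at h4; rw [hsucc _ hi] at hi'; omega
            · rw [hsucc _ (by rw [hlast i hi]; omega), hlast i hi] at h4; omega
          · exact hne (hcinj _ _ g2).symm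
        · exact hadd1 i (hcinj _ _ f2)
  · intro i
    have := hsuccmem (i - 1)
    rw [sub_add_cancel] at this
    exact Finset.mem_inter.2 ⟨this, hc _ (hle i)⟩
  · intro i j hij
    constructor
    · rintro ⟨x, hx⟩
      obtain ⟨hx, hx'⟩ := Finset.mem_inter.1 hx
      exact (hcyc i j hij x hx hx').imp And.left And.left
    · rintro (rfl | rfl)
      · exact ⟨_, Finset.mem_inter.2 ⟨hsuccmem i, hc _ (hle _)⟩⟩
      · exact ⟨_, Finset.mem_inter.2 ⟨hc _ (hle _), hsuccmem j⟩⟩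
  · rintro ⟨x, hx⟩
    -- Edges `0` and `2` are already disjoint, since `n ≥ 3`.
    have h0 : (0 : ZMod (n + 1)).val = 0 := ZMod.val_zero
    have h1 := hsucc 0 (by omega)
    have h2 := hsucc (0 + 1) (by omega)
    rw [h1, h0] at h2
    have a := hx 0
    have b := hx (0 + 1 + 1)
    simp only [h2, h0] at a b
    rcases hint 0 2 (by omega) (by omega) x a b with ⟨h, _⟩ | ⟨_, h, _⟩ <;> omega
  · intro i
    refine Finset.card_eq_one.2 ⟨c (i + 1).val, ?_⟩
    ext x
    simp only [Finset.mem_inter, Finset.mem_singleton]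
    constructor
    · rintro ⟨hx, hx'⟩
      rcases hcyc i (i + 1) (hadd1 i).symm x hx hx' with ⟨_, h⟩ | ⟨h, _⟩
      · exact h
      · exfalso
        have h4 := congrArg ZMod.val h
        rcases (hle i).lt_or_eq with hi | hi
        · rcases (hle (i + 1)).lt_or_eq with hi' | hi'
          · rw [hsucc _ hi', hsucc _ hi] at h4; omega
          · rw [hlast _ hi'] at h4; rw [hsucc _ hi] at hi'; omega
        · rw [hsucc _ (by rw [hlast i hi]; omega), hlast i hi] at h4; omega
    · rintro rfl
      exact ⟨hsuccmem i, hc _ (hle _)⟩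

theorem containsCycle_of_hasClosedWalk {H : Finset (Finset V)} {k : ℕ} (hk : 4 ≤ k)
    (h : HasClosedWalk (H : Set (Finset V)) k) : ContainsCycle k H := by
  obtain ⟨n, rfl⟩ : ∃ n, k = n + 1 := ⟨k - 1, by omega⟩
  obtain ⟨u, v, U, f, huv, h, hf, hu, hv, hfU⟩ := h.exists_closing_edge
  obtain ⟨e, c, hc0, hcn, h1, h2, h3, h4, h5, h6⟩ := h.exists_sequence
  have hEn : ∀ i < n, (if i < n then e i else f) = e i := fun i hi => if_pos hi
  have hEf : (if n < n then e n else f) = f := if_neg (lt_irrefl n)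
  refine containsCycle_of_sequence (by omega) (fun i => if i < n then e i else f) c ?_ ?_ ?_ ?_
    h3 ?_
  · intro i hi
    rcases hi.lt_or_eq with hi | rfl
    · simp only [hEn i hi]; exact (h1 i hi).1
    · simp only [hEf]; exact hf
  · intro i hi
    rcases hi.lt_or_eq with hi | rfl
    · simp only [hEn i hi]; exact (h1 i hi).2.1
    · simp only [hEf, hcn]; exact hv
  · intro i hi
    simp only [hEn i hi]; exact (h1 i hi).2.2.1
  · simp only [hEf, hc0]; exact hu
  · intro i j hij hj x hx hx'
    simp only [hEn i (by omega)] at hx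
    rcases hj.lt_or_eq with hj | rfl
    · simp only [hEn j hj] at hx'
      exact Or.inl (h4 i j hij hj x hx hx')
    · simp only [hEf] at hx'
      rcases hfU x ((h1 i hij).2.2.2 hx) hx' with rfl | rfl
      · exact Or.inr ⟨h5 i hij hx, rfl, hc0.symm⟩
      · exact Or.inl ⟨(h6 i hij hx).symm, hcn.symm⟩

theorem containsPath_of_hasClosedWalk {H : Finset (Finset V)} {k : ℕ}
    (h : HasClosedWalk (H : Set (Finset V)) (k + 1)) : ContainsPath k H := by
  obtain ⟨u, v, U, f, huv, h, hf, hu, hv, hfU⟩ := h.exists_closing_edge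
  exact containsPath_of_hasWalk ⟨_, _, _, h⟩

end Walks

/-! ### Full hypergraphs: deletion, avoidance, and greedy cycles -/

section Full

variable {V : Type*} [DecidableEq V]

theorem codegree_pos_of_mem_shadow {H : Finset (Finset V)} {S : Finset V} (hS : S ∈ ∂ H) :
    0 < codegree H S := by
  obtain ⟨e, he, a, ha, rfl⟩ := Finset.mem_shadow_iff.1 hS
  exact Finset.card_pos.2 ⟨e, Finset.mem_filter.2 ⟨he, Finset.erase_subset _ _⟩⟩

/-- Deleting all edges through a sub-edge of codegree at most `d` costs at most `d` edges and
removes that sub-edge from the shadow for good, so each member of `∂ H` is charged at most once. -/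
theorem exists_isFull_subfamily (d : ℕ) (H : Finset (Finset V)) :
    ∃ F ⊆ H, IsFull (d + 1) F ∧ H.card ≤ F.card + d * (∂ H).card := by
  induction hn : H.card using Nat.strong_induction_on generalizing H with
  | _ n ih =>
    by_cases hfull : IsFull (d + 1) H
    · exact ⟨H, subset_rfl, hfull, by omega⟩
    · obtain ⟨S, hS, hSd⟩ : ∃ S ∈ ∂ H, codegree H S < d + 1 := by
        simpa [IsFull] using hfull
      have hsplit := Finset.card_filter_add_card_filter_not (s := H) (fun e => S ⊆ e)
      have hpos := codegree_pos_of_mem_shadow hS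
      unfold codegree at hSd hpos
      obtain ⟨F, hF, hFf, hFc⟩ := ih _ (by omega) (H.filter fun e => ¬ S ⊆ e) rfl
      refine ⟨F, hF.trans (Finset.filter_subset _ _), hFf, ?_⟩
      have hsub : ∂ (H.filter fun e => ¬ S ⊆ e) ⊆ (∂ H).erase S := by
        intro T hT
        obtain ⟨e, he, a, ha, rfl⟩ := Finset.mem_shadow_iff.1 hT
        obtain ⟨he, hSe⟩ := Finset.mem_filter.1 he
        refine Finset.mem_erase.2 ⟨?_, Finset.mem_shadow_iff.2 ⟨e, he, a, ha, rfl⟩⟩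
        rintro rfl
        exact hSe (Finset.erase_subset _ _)
      have h1 := Finset.card_le_card hsub
      rw [Finset.card_erase_of_mem hS] at h1
      have h2 : 0 < (∂ H).card := Finset.card_pos.2 ⟨S, hS⟩
      have h3 : d * (∂ (H.filter fun e => ¬ S ⊆ e)).card + d ≤ d * (∂ H).card := by
        obtain ⟨t, ht⟩ : ∃ t, (∂ H).card = t + 1 := ⟨_, (Nat.succ_pred_eq_of_pos h2).symm⟩
        rw [ht] at h1 ⊢
        calc _ ≤ d * t + d := by gcongr; simpa using h1
          _ = _ := by ring
      omega

theorem codegree_eq_card_extensions [Fintype V] {s : ℕ} {H : Finset (Finset V)}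
    (hH : IsRGraph (s + 1) H) {S : Finset V} (hS : S.card = s) :
    codegree H S = (Finset.univ.filter fun v => v ∉ S ∧ insert v S ∈ H).card := by
  symm
  refine Finset.card_bij (fun v _ => insert v S) ?_ ?_ ?_
  · intro v hv
    simp only [Finset.mem_filter, Finset.mem_univ, true_and] at hv
    exact Finset.mem_filter.2 ⟨hv.2, Finset.subset_insert _ _⟩
  · intro v hv w hw hvw
    simp only [Finset.mem_filter, Finset.mem_univ, true_and] at hv hw
    have : v ∈ insert w S := hvw ▸ Finset.mem_insert_self v S
    exact (Finset.mem_insert.1 this).resolve_right hv.1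
  · intro e he
    obtain ⟨he, hSe⟩ := Finset.mem_filter.1 he
    have hc : e.card = s + 1 := hH he
    obtain ⟨v, hv⟩ : (e \ S).Nonempty := by
      rw [← Finset.card_pos, Finset.card_sdiff_of_subset hSe]
      omega
    obtain ⟨hv, hvS⟩ := Finset.mem_sdiff.1 hv
    have : insert v S = e := by
      refine Finset.eq_of_subset_of_card_le (Finset.insert_subset hv hSe) ?_
      rw [Finset.card_insert_of_notMem hvS, hc, hS]
    exact ⟨v, by simp [hvS, this, he], this⟩

theorem card_of_mem_shadow {s : ℕ} {H : Finset (Finset V)} (hH : IsRGraph (s + 1) H)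
    {S : Finset V} (hS : S ∈ ∂ H) : S.card = s := by
  obtain ⟨e, he, a, ha, rfl⟩ := Finset.mem_shadow_iff.1 hS
  have : e.card = s + 1 := hH he
  rw [Finset.card_erase_of_mem ha, this]
  rfl

theorem IsFull.exists_extension [Fintype V] {s d : ℕ} {H : Finset (Finset V)}
    (hH : IsRGraph (s + 1) H) (hf : IsFull d H) {S : Finset V} (hS : S ∈ ∂ H) {B : Finset V}
    (hB : B.card < d) : ∃ v, v ∉ S ∧ insert v S ∈ H ∧ v ∉ B := by
  have h := hf S hS
  rw [codegree_eq_card_extensions hH (card_of_mem_shadow hH hS)] at h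
  obtain ⟨v, hv, hvB⟩ := Finset.exists_mem_notMem_of_card_lt_card (hB.trans_le h)
  simp only [Finset.mem_filter, Finset.mem_univ, true_and] at hv
  exact ⟨v, hv.1, hv.2, hvB⟩

/-- The vertices of `e` in `B` outside `S` are exchanged one by one: the sub-edge left after
removing one has at least `d > |B|` extensions, so one of them avoids `B`. -/
theorem IsFull.exists_edge_avoiding [Fintype V] {s d : ℕ} {H : Finset (Finset V)}
    (hH : IsRGraph (s + 1) H) (hf : IsFull d H) {S B : Finset V} (hB : B.card < d) {e : Finset V}
    (he : e ∈ H) (hS : S ⊆ e) : ∃ e' ∈ H, S ⊆ e' ∧ ∀ x ∈ e', x ∈ B → x ∈ S := by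
  induction hn : ((e ∩ B) \ S).card using Nat.strong_induction_on generalizing e with
  | _ n ih =>
    by_cases h0 : ((e ∩ B) \ S) = ∅
    · refine ⟨e, he, hS, fun x hx hxB => ?_⟩
      by_contra hxS
      have : x ∈ (e ∩ B) \ S := by simp [hx, hxB, hxS]
      simp [h0] at this
    · obtain ⟨x, hx⟩ := Finset.nonempty_iff_ne_empty.2 h0
      have hx' := hx
      simp only [Finset.mem_sdiff, Finset.mem_inter] at hx'
      obtain ⟨v, hv, hve, hvB⟩ := hf.exists_extension hH
        (Finset.mem_shadow_iff.2 ⟨e, he, x, hx'.1.1, rfl⟩) hB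
      refine ih _ ?_ hve (fun y hy => ?_) rfl
      · rw [← hn]
        refine Finset.card_lt_card ⟨fun y hy => ?_, fun h => ?_⟩
        · simp only [Finset.mem_sdiff, Finset.mem_inter, Finset.mem_insert,
            Finset.mem_erase] at hy ⊢
          rcases hy.1.1 with rfl | h
          · exact absurd hy.1.2 hvB
          · exact ⟨⟨h.2, hy.1.2⟩, hy.2⟩
        · have := h hx
          simp only [Finset.mem_sdiff, Finset.mem_inter, Finset.mem_insert,
            Finset.mem_erase] at this
          rcases this.1.1 with rfl | h
          · exact hvB hx'.1.2
          · exact h.1 rfl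
      · refine Finset.mem_insert_of_mem (Finset.mem_erase.2 ⟨?_, hS hy⟩)
        rintro rfl
        exact hx'.2 hy

/-- The invariant is a walk together with an edge through both of its ends. That edge is first
rerouted to meet the walk only in the ends; a third vertex `w` of it becomes the new start, joined
to the old one by a fresh edge through `w` and `u`, and the rerouted edge links the new ends. -/
theorem IsFull.exists_walk [Fintype V] {s d : ℕ} {H : Finset (Finset V)} (hs : 2 ≤ s)
    (hH : IsRGraph (s + 1) H) (hf : IsFull d H) (hne : H.Nonempty) (n : ℕ)
    (hd : (n + 1) * (s + 1) < d) :
    ∃ u v U e, LinearWalk (H : Set (Finset V)) u v (n + 1) U ∧ U.card ≤ (n + 1) * (s + 1) ∧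
      u ≠ v ∧ e ∈ H ∧ u ∈ e ∧ v ∈ e := by
  induction n with
  | zero =>
    obtain ⟨e, he⟩ := hne
    have hc : e.card = s + 1 := hH he
    obtain ⟨u, hu, v, hv, huv⟩ := Finset.one_lt_card.1 (show 1 < e.card by omega)
    exact ⟨u, v, e, e, LinearWalk.single he hu hv huv, by omega, huv, he, hu, hv⟩
  | succ n ih =>
    have hd' : (n + 1) * (s + 1) < d := lt_of_le_of_lt (by gcongr; omega) hd
    obtain ⟨u, v, U, e, h, hU, huv, he, hu, hv⟩ := ih hd'
    obtain ⟨e', he', hS, hB⟩ := hf.exists_edge_avoiding hH (lt_of_le_of_lt hU hd') he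
      (S := {u, v}) (by simp [Finset.insert_subset_iff, hu, hv])
    have hu' : u ∈ e' := hS (by simp)
    have hv' : v ∈ e' := hS (by simp)
    have hc : e'.card = s + 1 := hH he'
    -- An edge has at least three vertices because `s ≥ 2`.
    obtain ⟨w, hw, hwuv⟩ := Finset.exists_mem_notMem_of_card_lt_card
      (show ({u, v} : Finset V).card < e'.card by have := Finset.card_le_two (a := u) (b := v); omega)
    have hwU : w ∉ U := fun h => hwuv (hB w hw h)
    have hwu : w ≠ u := by rintro rfl; simp at hwuv
    have hwv : w ≠ v := by rintro rfl; simp at hwuv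
    obtain ⟨f, hf', hSf, hBf⟩ := hf.exists_edge_avoiding hH (lt_of_le_of_lt hU hd') he'
      (S := {w, u}) (by simp [Finset.insert_subset_iff, hu', hw])
    refine ⟨w, v, f ∪ U, e', LinearWalk.cons hf' (hSf (by simp)) (hSf (by simp)) hwu ?_ h, ?_,
      hwv, he', hw, hv'⟩
    · intro x hx hxU
      have := hBf x hx hxU
      simp only [Finset.mem_insert, Finset.mem_singleton] at this
      rcases this with rfl | rfl
      · exact absurd hxU hwU
      · rfl
    · have hcf : f.card = s + 1 := hH hf'
      calc (f ∪ U).card ≤ f.card + U.card := Finset.card_union_le _ _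
        _ ≤ (s + 1) + (n + 1) * (s + 1) := by omega
        _ = _ := by ring

theorem IsFull.hasClosedWalk [Fintype V] {s d : ℕ} {H : Finset (Finset V)} (hs : 2 ≤ s)
    (hH : IsRGraph (s + 1) H) (hf : IsFull d H) (hne : H.Nonempty) (n : ℕ)
    (hd : (n + 1) * (s + 1) < d) : HasClosedWalk (H : Set (Finset V)) (n + 2) := by
  obtain ⟨u, v, U, e, h, hU, huv, he, hu, hv⟩ := hf.exists_walk hs hH hne n hd
  obtain ⟨e', he', hS, hB⟩ := hf.exists_edge_avoiding hH (lt_of_le_of_lt hU hd) he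
      (S := {u, v}) (by simp [Finset.insert_subset_iff, hu, hv])
  refine ⟨u, v, n + 1, 1, U, e', huv, h, LinearWalk.single he' (hS (by simp)) (hS (by simp))
    huv.symm, fun x hx hx' => ?_, rfl⟩
  simpa using hB x hx' hx

end Full

theorem LinearWalk.superset {V : Type*} [DecidableEq V] {G H : Set (Finset V)} {n : ℕ} {u v : V}
    {U : Finset V} (h : LinearWalk G u v n U) (hGH : G ⊆ H) : LinearWalk H u v n U := by
  induction h with
  | nil => exact .nil _
  | cons he hu hv huv hU h ih => exact .cons (hGH he) hu hv huv hU ih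

theorem HasClosedWalk.superset {V : Type*} [DecidableEq V] {G H : Set (Finset V)} {n : ℕ}
    (h : HasClosedWalk G n) (hGH : G ⊆ H) : HasClosedWalk H n := by
  obtain ⟨u, v, a, b, U, U', huv, h, h', hUU', hab⟩ := h
  exact ⟨u, v, a, b, U, U', huv, h.superset hGH, h'.superset hGH, hUU', hab⟩

/-! ### Counting boxes, and boxes without accidental coincidences -/

section Boxes

/-- The tuple `(x j (ι j))_j` selected by `ι` in the box `x`. -/
def row {V I : Type*} {s : ℕ} (x : Fin s → I → V) (ι : Fin s → I) : Fin s → V :=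
  fun j => x j (ι j)

theorem le_sum_pow_of_le_sum {α : Type*} [Fintype α] (f : α → ℝ) (hf : ∀ a, 0 ≤ f a) {c : ℝ}
    (hc : 0 ≤ c) (h : c * Fintype.card α ≤ ∑ a, f a) (M : ℕ) :
    c ^ M * Fintype.card α ≤ ∑ a, f a ^ M := by
  cases M with
  | zero => simp
  | succ k =>
    have h1 := pow_sum_div_card_le_sum_pow (s := Finset.univ) (f := f) (fun a _ => hf a) k
    refine le_trans ?_ h1
    rcases Nat.eq_zero_or_pos (Fintype.card α) with h0 | h0
    · rw [h0]; simp only [Nat.cast_zero, mul_zero]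
      exact div_nonneg (pow_nonneg (Finset.sum_nonneg fun a _ => hf a) _) (by positivity)
    · have h0' : (0 : ℝ) < Fintype.card α := by exact_mod_cast h0
      rw [Finset.card_univ, le_div_iff₀ (by positivity)]
      calc c ^ (k + 1) * Fintype.card α * (Fintype.card α : ℝ) ^ k
          = (c * Fintype.card α) ^ (k + 1) := by ring
        _ ≤ _ := by gcongr

variable {V : Type*} [Fintype V] [DecidableEq V]

/-- Induction on `s` with the power mean inequality used twice: on degrees in the first coordinate,
so that the `m`-fold slices have average density at least `θ ^ m`, and then on the densities of the
slices, to which the induction hypothesis applies. Degenerate boxes are counted too. -/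
theorem le_card_boxes (m : ℕ) (hm : 1 ≤ m) (s : ℕ) (D : Finset (Fin s → V)) {θ : ℝ} (hθ : 0 ≤ θ)
    (hD : θ * (Fintype.card V : ℝ) ^ s ≤ D.card) :
    θ ^ (m ^ s) * (Fintype.card V : ℝ) ^ (s * m) ≤
      (Finset.univ.filter fun x : Fin s → Fin m → V => ∀ ι, row x ι ∈ D).card := by
  induction s generalizing θ with
  | zero =>
    simp only [pow_zero, mul_one, pow_one, zero_mul] at hD ⊢
    refine hD.trans ?_
    rcases D.eq_empty_or_nonempty with rfl | ⟨S, hS⟩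
    · simp
    · have h1 : D.card ≤ 1 := Finset.card_le_one.2 fun a _ b _ => Subsingleton.elim _ _
      have h2 : 0 < (Finset.univ.filter fun x : Fin 0 → Fin m → V => ∀ ι, row x ι ∈ D).card := by
        refine Finset.card_pos.2 ⟨fun j => j.elim0, Finset.mem_filter.2 ⟨Finset.mem_univ _, ?_⟩⟩
        intro ι
        rw [Subsingleton.elim (row _ ι) S]
        exact hS
      exact_mod_cast h1.trans h2
  | succ s ih =>
    rcases Nat.eq_zero_or_pos (Fintype.card V) with h0 | h0
    · rw [h0, Nat.cast_zero, zero_pow (by positivity), mul_zero]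
      positivity
    have hn : (0 : ℝ) < Fintype.card V := by exact_mod_cast h0
    set n : ℝ := (Fintype.card V : ℝ) with hndef
    let slice : (Fin m → V) → Finset (Fin s → V) := fun y =>
      Finset.univ.filter fun T => ∀ i, (Fin.cons (y i) T : Fin (s + 1) → V) ∈ D
    let deg : (Fin s → V) → ℕ := fun T =>
      (Finset.univ.filter fun v => (Fin.cons v T : Fin (s + 1) → V) ∈ D).card
    have hdeg : ∑ T, deg T = D.card := by
      simp only [deg, Finset.card_filter]
      rw [Finset.sum_comm, ← Fintype.sum_prod_type'
        (f := fun (v : V) (T : Fin s → V) => if (Fin.cons v T : Fin (s + 1) → V) ∈ D then 1 else 0)]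
      refine (Fintype.sum_equiv (Fin.consEquiv fun _ => V) _
        (fun S : Fin (s + 1) → V => if S ∈ D then 1 else 0) (fun _ => rfl)).trans ?_
      simp
    have hslice : ∑ y, (slice y).card = ∑ T, deg T ^ m := by
      simp only [slice, Finset.card_filter]
      rw [Finset.sum_comm]
      refine Finset.sum_congr rfl fun T _ => ?_
      rw [← Finset.card_filter]
      have := Fintype.card_piFinset_const
        (Finset.univ.filter fun v => (Fin.cons v T : Fin (s + 1) → V) ∈ D) m
      rw [← this]
      congr 1
      ext y
      simp
    have hcount : (Finset.univ.filter fun x : Fin (s + 1) → Fin m → V => ∀ ι, row x ι ∈ D).card =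
        ∑ y, (Finset.univ.filter fun x : Fin s → Fin m → V => ∀ ι, row x ι ∈ slice y).card := by
      simp only [Finset.card_filter]
      rw [← Fintype.sum_prod_type' (f := fun (y : Fin m → V) (x : Fin s → Fin m → V) =>
        if ∀ ι, row x ι ∈ slice y then 1 else 0)]
      symm
      refine Fintype.sum_equiv (Fin.consEquiv fun _ => Fin m → V) _ _ fun z => ?_
      obtain ⟨y, x⟩ := z
      refine if_congr ?_ rfl rfl
      simp only [slice, Finset.mem_filter, Finset.mem_univ, true_and]
      have hrow : ∀ (i : Fin m) (ι : Fin s → Fin m),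
          row (Fin.cons y x : Fin (s + 1) → Fin m → V) (Fin.cons i ι) =
            Fin.cons (y i) (row x ι) := by
        intro i ι
        funext j
        refine Fin.cases ?_ (fun j => ?_) j <;> simp [row]
      constructor
      · intro h ι
        have := h (Fin.tail ι) (ι 0)
        rw [← hrow, Fin.cons_self_tail] at this
        exact this
      · intro h ι i
        rw [← hrow]
        exact h _
    have h1 := le_sum_pow_of_le_sum (fun T => (deg T : ℝ)) (fun _ => by positivity)
      (c := θ * n) (by positivity) (by
        rw [← Nat.cast_sum, hdeg, Fintype.card_fun, Fintype.card_fin, Nat.cast_pow]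
        calc _ = θ * n ^ (s + 1) := by rw [← hndef]; ring
          _ ≤ _ := hD) m
    have h2 := le_sum_pow_of_le_sum (fun y => ((slice y).card : ℝ) / n ^ s)
      (fun _ => by positivity) (c := θ ^ m) (by positivity) (by
        rw [← Finset.sum_div, ← Nat.cast_sum, hslice, le_div_iff₀ (by positivity)]
        push_cast
        refine le_trans (le_of_eq ?_) h1
        simp only [Fintype.card_fun, Fintype.card_fin, Nat.cast_pow, ← hndef]
        ring) (m ^ s)
    rw [hcount]
    push_cast
    calc θ ^ m ^ (s + 1) * n ^ ((s + 1) * m)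
        = ((θ ^ m) ^ m ^ s * Fintype.card (Fin m → V)) * n ^ (s * m) := by
          simp only [Fintype.card_fun, Fintype.card_fin, Nat.cast_pow, ← hndef]
          ring
      _ ≤ (∑ y, (((slice y).card : ℝ) / n ^ s) ^ m ^ s) * n ^ (s * m) := by gcongr
      _ = ∑ y, (((slice y).card : ℝ) / n ^ s) ^ m ^ s * n ^ (s * m) := by rw [Finset.sum_mul]
      _ ≤ _ := by
          refine Finset.sum_le_sum fun y _ => ih (slice y) (by positivity) ?_
          rw [div_mul_cancel₀ _ (by positivity)]

theorem card_row_mem (m : ℕ) {s : ℕ} (D : Finset (Fin s → V)) (ι : Fin s → Fin m) :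
    (Finset.univ.filter fun x : Fin s → Fin m → V => row x ι ∈ D).card =
      D.card * Fintype.card V ^ (s * (m - 1)) := by
  rw [Finset.card_eq_sum_card_fiberwise (f := fun x => row x ι) (t := D)
    (fun x hx => by simpa using hx), Finset.sum_const_nat]
  intro S hS
  have : (Finset.univ.filter fun x : Fin s → Fin m → V => row x ι ∈ D).filter
      (fun x => row x ι = S) = Fintype.piFinset fun j => Fintype.piFinset fun i =>
        if i = ι j then {S j} else Finset.univ := by
    ext x
    simp only [Finset.mem_filter, Finset.mem_univ, true_and, Fintype.mem_piFinset]
    constructor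
    · rintro ⟨-, rfl⟩ j i
      split_ifs with h
      · subst h; simp [row]
      · simp
    · intro h
      have : row x ι = S := by
        funext j
        simpa [row] using h j (ι j)
      exact ⟨this ▸ hS, this⟩
  rw [this, Fintype.card_piFinset]
  have h2 : ∀ j, (Fintype.piFinset fun i => if i = ι j then {S j} else (Finset.univ : Finset V)).card
      = Fintype.card V ^ (m - 1) := by
    intro j
    rw [Fintype.card_piFinset, ← Finset.mul_prod_erase _ _ (Finset.mem_univ (ι j))]
    rw [if_pos rfl, Finset.card_singleton, one_mul, Finset.prod_congr rfl
      (g := fun _ => Fintype.card V)]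
    · rw [Finset.prod_const, Finset.card_erase_of_mem (Finset.mem_univ _), Finset.card_univ,
        Fintype.card_fin]
    · intro i hi
      rw [if_neg (Finset.ne_of_mem_erase hi), Finset.card_univ]
  simp only [h2, Finset.prod_const, Finset.card_univ, Fintype.card_fin]
  rw [← pow_mul, mul_comm]

/-- On the tuples of `D`, no function of the coordinates in `J` agrees with `f` on more than
`η |V| ^ s` tuples. -/
def Spread {s : ℕ} (D : Finset (Fin s → V)) (f : (Fin s → V) → V) (J : Finset (Fin s)) (η : ℝ) :
    Prop :=
  ∀ g : (Fin s → V) → V, (∀ S S', (∀ j ∈ J, S j = S' j) → g S = g S') →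
    ((D.filter fun S => f S = g S).card : ℝ) ≤ η * (Fintype.card V : ℝ) ^ s

/-- Fix all entries of the box except those used by `ι'` outside `J`. Then `h (row x ι)` is fixed,
since `ι` uses none of the free entries, and so are the `J`-coordinates of the row `ι'`. Hence
collisions are at most as frequent as for the best guess of `f` from the `J`-coordinates, which
spreadness bounds. -/
theorem Spread.card_collisions_le [Nonempty V] {s m : ℕ} (hm : 1 ≤ m) {D : Finset (Fin s → V)}
    {f : (Fin s → V) → V} {J : Finset (Fin s)} {η : ℝ} (hf : Spread D f J η)
    (h : (Fin s → V) → V) {ι ι' : Fin s → Fin m} (hι : ∀ j, ι j = ι' j ↔ j ∈ J) :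
    ((Finset.univ.filter fun x : Fin s → Fin m → V =>
      row x ι' ∈ D ∧ f (row x ι') = h (row x ι)).card : ℝ) ≤
        η * (Fintype.card V : ℝ) ^ (s * m) := by
  let c : (J → V) → V → ℕ := fun ρ v =>
    (D.filter fun S => (∀ j : J, S j = ρ j) ∧ f S = v).card
  -- `G ρ` is the most frequent value of `f` on tuples of `D` that restrict to `ρ` on `J`.
  choose G hG using fun ρ => Finite.exists_max (c ρ)
  let g : (Fin s → V) → V := fun S => G fun j => S j
  set D' := D.filter fun S => f S = g S with hD'
  have hD'c : (D'.card : ℝ) ≤ η * (Fintype.card V : ℝ) ^ s :=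
    hf g fun S S' hS => by
      have : (fun j : J => S j) = fun j : J => S' j := funext fun j => hS j j.2
      simp only [g, this]
  obtain ⟨v₀⟩ := ‹Nonempty V›
  let bar : (Fin s → Fin m → V) → (Fin s → Fin m → V) := fun x j i =>
    if j ∉ J ∧ i = ι' j then v₀ else x j i
  have key : (Finset.univ.filter fun x : Fin s → Fin m → V =>
      row x ι' ∈ D ∧ f (row x ι') = h (row x ι)).card ≤
      (Finset.univ.filter fun x : Fin s → Fin m → V => row x ι' ∈ D').card := by
    rw [Finset.card_eq_sum_card_fiberwise (f := bar) (t := Finset.univ) (fun x _ => by simp),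
      Finset.card_eq_sum_card_fiberwise (f := bar) (t := Finset.univ) (fun x _ => by simp)]
    refine Finset.sum_le_sum fun b _ => ?_
    by_cases hb : bar b = b
    · refine le_trans (b := c (fun j => row b ι' j) (h (row b ι))) ?_
        ((hG _ _).trans ?_)
      · refine Finset.card_le_card_of_injOn (fun x => row x ι') ?_ ?_
        · intro x hx
          simp only [Finset.coe_filter, Finset.mem_filter, Finset.mem_univ, true_and,
            Set.mem_ofPred_eq] at hx ⊢
          obtain ⟨⟨h1, h2⟩, rfl⟩ := hx
          refine ⟨h1, fun j => ?_, ?_⟩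
          · simp [row, bar]
          · rw [h2]
            congr 1
            funext j
            simp only [row, bar]
            rw [if_neg]
            rintro ⟨h3, h4⟩
            exact h3 ((hι j).1 h4)
        · intro x hx y hy hxy
          simp only [Finset.coe_filter, Finset.mem_filter, Finset.mem_univ, true_and,
            Set.mem_ofPred_eq] at hx hy
          funext j i
          by_cases hji : j ∉ J ∧ i = ι' j
          · obtain ⟨-, rfl⟩ := hji
            exact congrFun hxy j
          · have := congrFun (congrFun (hx.2.trans hy.2.symm) j) i
            simpa only [bar, if_neg hji] using this
      · refine Finset.card_le_card_of_injOn
          (fun S => fun j i => if i = ι' j then S j else b j i) ?_ ?_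
        · intro S hS
          simp only [Finset.coe_filter, Finset.mem_filter, Finset.mem_univ, true_and,
            Set.mem_ofPred_eq] at hS ⊢
          have hrow : row (fun j i => if i = ι' j then S j else b j i) ι' = S := by
            funext j; simp [row]
          rw [hrow, hD', Finset.mem_filter]
          refine ⟨⟨hS.1, hS.2.2.trans ?_⟩, ?_⟩
          · simp only [g]
            congr 1
            funext j
            exact (hS.2.1 j).symm
          · funext j i
            have hbji := congrFun (congrFun hb j) i
            simp only [bar] at hbji ⊢
            split_ifs at hbji ⊢ with h1 h2
            · exact hbji
            · subst h2
              have hj : j ∈ J := by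
                by_contra hj
                exact h1 ⟨hj, rfl⟩
              exact hS.2.1 ⟨j, hj⟩
            · rfl
        · intro S _ S' _ hSS'
          funext j
          have := congrFun (congrFun hSS' j) (ι' j)
          simpa using this
    · rw [Finset.card_eq_zero.2]
      · exact Nat.zero_le _
      · refine Finset.filter_eq_empty_iff.2 fun x _ hx => hb ?_
        rw [← hx]
        funext j i
        simp only [bar]
        split_ifs <;> rfl
  rw [card_row_mem m] at key
  calc _ ≤ ((D'.card * Fintype.card V ^ (s * (m - 1)) : ℕ) : ℝ) := by exact_mod_cast key
    _ = D'.card * (Fintype.card V : ℝ) ^ (s * (m - 1)) := by push_cast; rfl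
    _ ≤ η * (Fintype.card V : ℝ) ^ s * (Fintype.card V : ℝ) ^ (s * (m - 1)) := by gcongr
    _ = η * (Fintype.card V : ℝ) ^ (s * m) := by
      obtain ⟨m', rfl⟩ : ∃ m', m = m' + 1 := ⟨m - 1, by omega⟩
      rw [mul_assoc, ← pow_add]
      congr 2
      rw [Nat.add_sub_cancel]
      ring

end Boxes

/-- Union bound: each pair of functions and pair of rows spoils at most an `η` fraction of all
boxes, and `η` is chosen so that the total stays below the fraction `θ ^ (m ^ s)` of boxes with all
rows in `D`. -/
theorem exists_box (s m : ℕ) (hm : 1 ≤ m) {θ : ℝ} (hθ : 0 < θ) (P : Type) [Fintype P] :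
    ∃ η : ℝ, 0 < η ∧ ∀ (V : Type*) [Fintype V] [DecidableEq V] [Nonempty V]
      (D : Finset (Fin s → V)), θ * (Fintype.card V : ℝ) ^ s ≤ D.card →
      ∀ F : P → (Fin s → V) → V, ∃ x : Fin s → Fin m → V, (∀ ι, row x ι ∈ D) ∧
        ∀ (p q : P) (J : Finset (Fin s)) (ι ι' : Fin s → Fin m), (∀ j, ι j = ι' j ↔ j ∈ J) →
          Spread D (F q) J η → F p (row x ι) ≠ F q (row x ι') := by
  classical
  let E := P × P × (Fin s → Fin m) × (Fin s → Fin m)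
  refine ⟨θ ^ (m ^ s) / (Fintype.card E + 1), by positivity, ?_⟩
  intro V _ _ _ D hD F
  set n : ℝ := (Fintype.card V : ℝ)
  have hn : 0 < n := Nat.cast_pos.2 Fintype.card_pos
  set η := θ ^ (m ^ s) / (Fintype.card E + 1)
  have hη : 0 < η := by positivity
  by_contra hcon
  push Not at hcon
  let J : E → Finset (Fin s) := fun t => Finset.univ.filter fun j => t.2.2.1 j = t.2.2.2 j
  let bad : E → Finset (Fin s → Fin m → V) := fun t =>
    if Spread D (F t.2.1) (J t) η then Finset.univ.filter fun x : Fin s → Fin m → V =>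
      row x t.2.2.2 ∈ D ∧ F t.2.1 (row x t.2.2.2) = F t.1 (row x t.2.2.1) else ∅
  have hsub : (Finset.univ.filter fun x : Fin s → Fin m → V => ∀ ι, row x ι ∈ D) ⊆
      Finset.univ.biUnion bad := by
    intro x hx
    have hx := (Finset.mem_filter.1 hx).2
    obtain ⟨p, q, J', ι, ι', hι, hs, heq⟩ := hcon x hx
    refine Finset.mem_biUnion.2 ⟨(p, q, ι, ι'), Finset.mem_univ _, ?_⟩
    have hJ : J (p, q, ι, ι') = J' := by
      ext j
      simp [J, hι]
    simp only [bad, hJ, if_pos hs]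
    exact Finset.mem_filter.2 ⟨Finset.mem_univ _, hx _, heq.symm⟩
  have hbad : ∀ t, ((bad t).card : ℝ) ≤ η * n ^ (s * m) := by
    intro t
    simp only [bad]
    split_ifs with h
    · exact h.card_collisions_le hm (F t.1) (fun j => by simp [J])
    · simp only [Finset.card_empty, Nat.cast_zero]; positivity
  have h1 := le_card_boxes m hm s D hθ.le hD
  have h2 : ((Finset.univ.filter fun x : Fin s → Fin m → V => ∀ ι, row x ι ∈ D).card : ℝ) ≤
      Fintype.card E * (η * n ^ (s * m)) := by
    calc _ ≤ ((Finset.univ.biUnion bad).card : ℝ) := by exact_mod_cast Finset.card_le_card hsub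
      _ ≤ ((∑ t, (bad t).card : ℕ) : ℝ) := by exact_mod_cast Finset.card_biUnion_le
      _ = ∑ t, ((bad t).card : ℝ) := by push_cast; rfl
      _ ≤ ∑ t : E, η * n ^ (s * m) := Finset.sum_le_sum fun t _ => hbad t
      _ = _ := by rw [Finset.sum_const, Finset.card_univ, nsmul_eq_mul]
  have h3 : θ ^ (m ^ s) = η * (Fintype.card E + 1) := by
    simp only [η]; field_simp
  rw [h3] at h1
  have h4 : 0 < η * n ^ (s * m) := by positivity
  nlinarith

/-- Since the bound is normalised by `|V| ^ s` and not by `|D|`, spreadness survives passing to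
subfamilies with the same `η`. -/
theorem Spread.anti {V : Type*} [Fintype V] [DecidableEq V] {s : ℕ} {D D' : Finset (Fin s → V)}
    {f : (Fin s → V) → V} {J J' : Finset (Fin s)} {η η' : ℝ} (h : Spread D f J η) (hD : D' ⊆ D)
    (hJ : J' ⊆ J) (hη : η ≤ η') : Spread D' f J' η' := by
  intro g hg
  calc ((D'.filter fun S => f S = g S).card : ℝ)
      ≤ ((D.filter fun S => f S = g S).card : ℝ) := by
        exact_mod_cast Finset.card_le_card (Finset.filter_subset_filter _ hD)
    _ ≤ η * (Fintype.card V : ℝ) ^ s := h g fun S S' hS => hg S S' fun j hj => hS j (hJ hj)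
    _ ≤ _ := by gcongr

/-- Fixing one coordinate leaves at most `|V| ^ (s - 1)` tuples, a vanishing proportion. -/
theorem spread_coordinate {V : Type*} [Fintype V] [DecidableEq V] {s : ℕ}
    (D : Finset (Fin s → V)) (j : Fin s) {η : ℝ} (hη : 1 ≤ η * Fintype.card V) :
    Spread D (fun S => S j) ∅ η := by
  intro g hg
  rcases D.eq_empty_or_nonempty with rfl | ⟨S₀, -⟩
  · have : 0 < η := by
      by_contra h
      have : η * Fintype.card V ≤ 0 := mul_nonpos_of_nonpos_of_nonneg (not_lt.1 h) (by positivity)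
      linarith
    simp only [Finset.filter_empty, Finset.card_empty, Nat.cast_zero]
    positivity
  have hsub : (D.filter fun S => S j = g S) ⊆ Fintype.piFinset fun i =>
      if i = j then {g S₀} else Finset.univ := by
    intro S hS
    refine Fintype.mem_piFinset.2 fun i => ?_
    split_ifs with h
    · subst h
      rw [Finset.mem_singleton, hg S₀ S (by simp)]
      exact (Finset.mem_filter.1 hS).2
    · exact Finset.mem_univ _
  have hcard := Finset.card_le_card hsub
  rw [Fintype.card_piFinset, ← Finset.mul_prod_erase _ _ (Finset.mem_univ j), if_pos rfl,
    Finset.card_singleton, one_mul, Finset.prod_congr rfl (g := fun _ => Fintype.card V)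
      (fun i hi => by rw [if_neg (Finset.ne_of_mem_erase hi), Finset.card_univ]),
    Finset.prod_const, Finset.card_erase_of_mem (Finset.mem_univ _), Finset.card_univ,
    Fintype.card_fin] at hcard
  obtain ⟨t, rfl⟩ : ∃ t, s = t + 1 := ⟨s - 1, by have := j.pos; omega⟩
  calc ((D.filter fun S => S j = g S).card : ℝ) ≤ 1 * (Fintype.card V : ℝ) ^ t := by
        rw [one_mul]; exact_mod_cast hcard
    _ ≤ η * Fintype.card V * (Fintype.card V : ℝ) ^ t := by gcongr
    _ = _ := by ring

/-- Boxes `x` in a dense family `D` of injective tuples, indexed by naturals below `m`, such that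
all vertices of the box and all values of the functions `F p` on its rows are distinct unless there
is a reason for them to be equal. -/
theorem exists_separated_box (s m : ℕ) (hm : 2 ≤ m) {θ : ℝ} (hθ : 0 < θ) (P : Type) [Fintype P] :
    ∃ η : ℝ, 0 < η ∧ ∃ N : ℕ, ∀ (V : Type*) [Fintype V] [DecidableEq V], N ≤ Fintype.card V →
      ∀ D : Finset (Fin s → V), θ * (Fintype.card V : ℝ) ^ s ≤ D.card →
      (∀ S ∈ D, Function.Injective S) →
      ∀ F : P → (Fin s → V) → V, (∀ p, ∀ S ∈ D, ∀ j, F p S ≠ S j) →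
      ∃ x : Fin s → ℕ → V, (∀ ι : Fin s → ℕ, (∀ j, ι j < m) → row x ι ∈ D) ∧
        (∀ j j' i i', i < m → i' < m → x j i = x j' i' → j = j' ∧ i = i') ∧
        (∀ p (ι : Fin s → ℕ), (∀ j, ι j < m) → ∀ j i, i < m → F p (row x ι) ≠ x j i) ∧
        ∀ (p q : P) (J : Finset (Fin s)) (ι ι' : Fin s → ℕ), (∀ j, ι j < m) → (∀ j, ι' j < m) →
          (∀ j, ι j = ι' j ↔ j ∈ J) → Spread D (F q) J η → F p (row x ι) ≠ F q (row x ι') := by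
  -- Adjoining the coordinate projections to the family `F` makes the box vertices themselves
  -- subject to the separation.
  obtain ⟨η, hη, hbox⟩ := exists_box s m (by omega) hθ (P ⊕ Fin s)
  obtain ⟨N, hN⟩ := exists_nat_ge (1 / η)
  refine ⟨η, hη, N + 1, fun V _ _ hV D hD hinj F hF => ?_⟩
  have hne : Nonempty V := Fintype.card_pos_iff.1 (by omega)
  have hηV : 1 ≤ η * Fintype.card V := by
    have h1 : (N : ℝ) ≤ Fintype.card V := by exact_mod_cast (by omega : N ≤ Fintype.card V)
    have h2 := (div_le_iff₀ hη).1 (hN.trans h1)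
    linarith
  obtain ⟨x, hx, hsep⟩ := hbox V D hD (Sum.elim F fun j S => S j)
  have hm0 : 0 < m := by omega
  let κ : ℕ → Fin m := fun i => ⟨i % m, Nat.mod_lt _ hm0⟩
  have hκ : ∀ i i', i < m → i' < m → (κ i = κ i' ↔ i = i') := by
    intro i i' hi hi'
    simp only [κ, Fin.mk.injEq, Nat.mod_eq_of_lt hi, Nat.mod_eq_of_lt hi']
  have hother : ∀ i, i < m → ∃ i' : ℕ, i' < m ∧ i' ≠ i := by
    intro i hi
    by_cases h : i = 0
    · exact ⟨1, by omega, by omega⟩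
    · exact ⟨0, by omega, by omega⟩
  have hproj : ∀ (a : P ⊕ Fin s) (j : Fin s) (ι ι' : Fin s → Fin m), (∀ k, ι k ≠ ι' k) →
      Sum.elim F (fun j S => S j) a (row x ι) ≠ x j (ι' j) := fun a j ι ι' hι =>
    hsep a (Sum.inr j) ∅ ι ι' (by simpa using hι) (spread_coordinate D j hηV)
  have hsame : ∀ j i i', i < m → i' < m → x j (κ i) = x j (κ i') → i = i' := by
    intro j i i' hi hi' h
    by_contra hne
    exact hproj (Sum.inr j) j (fun _ => κ i) (fun _ => κ i')
      (fun _ h' => hne ((hκ i i' hi hi').1 h')) h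
  refine ⟨fun j i => x j (κ i), fun ι _ => hx fun j => κ (ι j), ?_, ?_, ?_⟩
  · intro j j' i i' hi hi' h
    have hj : j = j' := by
      by_contra hjj
      -- Vertices in different coordinates lie in a common row, and rows are injective.
      refine hjj (hinj _ (hx fun k => if k = j then κ i else κ i') ?_)
      simpa [row, Ne.symm hjj] using h
    subst hj
    exact ⟨rfl, hsame j i i' hi hi' h⟩
  · intro p ι hι j i hi h
    by_cases hij : i = ι j
    · subst hij
      exact hF p _ (hx fun j => κ (ι j)) j h
    -- A row through `x j i` that disagrees with `ι` everywhere; this is where `2 ≤ m` is needed.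
    · choose o ho ho' using fun k => hother (ι k) (hι k)
      refine hproj (Sum.inl p) j (fun k => κ (ι k))
        (fun k => if k = j then κ i else κ (o k)) (fun k hk => ?_) (by simp only [if_true]; exact h)
      split_ifs at hk with hkj
      · subst hkj
        exact hij ((hκ _ _ (hι k) hi).1 hk).symm
      · exact ho' k ((hκ _ _ (hι k) (ho k)).1 hk).symm
  · intro p q J ι ι' hι hι' hJ hs
    exact hsep (Sum.inl p) (Sum.inl q) J (fun k => κ (ι k)) (fun k => κ (ι' k))
      (fun k => by rw [hκ _ _ (hι k) (hι' k), hJ]) hs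

/-! ### Explicit walks on abstract boxes -/

/-- Abstract vertices of a configuration: the vertices of an `s`-dimensional box, and vertices
extending its rows to edges. -/
inductive Tag (s : ℕ)
  | box (c : Fin s) (i : ℕ)
  | ext (h : ℕ)
  deriving DecidableEq

namespace Tag

variable {s : ℕ}

/-- The row of a box with index `i` in coordinate `p`, `j` in coordinate `q`, `t` elsewhere. -/
def idx (p q : Fin s) (i j t : ℕ) : Fin s → ℕ :=
  fun c => if c = p then i else if c = q then j else t

/-- The row `ι` extended by the vertex `ext h`. -/
def rowEdge (ι : Fin s → ℕ) (h : ℕ) : Finset (Tag s) :=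
  insert (ext h) (Finset.univ.image fun c => box c (ι c))

@[simp]
theorem box_mem_rowEdge {ι : Fin s → ℕ} {h i : ℕ} {c : Fin s} :
    box c i ∈ rowEdge ι h ↔ i = ι c := by
  simp only [rowEdge, Finset.mem_insert, reduceCtorEq, Finset.mem_image, Finset.mem_univ, true_and,
    box.injEq, false_or]
  constructor
  · rintro ⟨a, rfl, rfl⟩; rfl
  · rintro rfl; exact ⟨c, rfl, rfl⟩

@[simp]
theorem ext_mem_rowEdge {ι : Fin s → ℕ} {h k : ℕ} :
    (ext k : Tag s) ∈ rowEdge ι h ↔ k = h := by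
  simp [rowEdge]

variable {G : Set (Finset (Tag s))} {p q : Fin s} {P : ℕ}

theorem idx_left (p q : Fin s) (i j t : ℕ) : idx p q i j t p = i := if_pos rfl

theorem idx_right (hpq : p ≠ q) (i j t : ℕ) : idx p q i j t q = j := by
  simp [idx, hpq.symm]

/-- The connecting vertices alternate between the coordinates `q` and `p`; every edge has its own
extension vertex, and the remaining coordinates use the edge number and so never repeat. The bounds
on `U` let later edges be attached by arithmetic. -/
theorem exists_alternating_walk (hpq : p ≠ q)
    (hA : ∀ i < P, rowEdge (idx p q i i (2 * i)) (2 * i) ∈ G)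
    (hB : ∀ i < P, rowEdge (idx p q i (i + 1) (2 * i + 1)) (2 * i + 1) ∈ G) :
    ∃ U, LinearWalk G (box q 0) (box q P) (2 * P) U ∧
      (∀ c i, box c i ∈ U → (c = p → i < P) ∧ (c = q → i ≤ P) ∧ (c ≠ p → c ≠ q → i < 2 * P)) ∧
      ∀ h, ext h ∈ U → h < 2 * P := by
  induction P with
  | zero =>
    refine ⟨_, LinearWalk.nil _, ?_, ?_⟩
    · intro c i hci
      obtain ⟨rfl, rfl⟩ : c = q ∧ i = 0 := by simpa using hci
      simp [hpq.symm]
    · simp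
  | succ P ih =>
    obtain ⟨U, hU, hbox, hext⟩ := ih (fun i hi => hA i (by omega)) (fun i hi => hB i (by omega))
    have h1 := hU.snoc (w := box p P) (hA P (by omega)) (by simp [idx, hpq.symm])
      (by simp [idx]) (by simp [hpq.symm]) (fun t ht ht' => by
        rcases t with ⟨c, i⟩ | h
        · have := hbox c i ht
          simp only [box_mem_rowEdge, idx] at ht'
          grind
        · have := hext h ht
          simp only [ext_mem_rowEdge] at ht'
          omega)
    have h2 := h1.snoc (w := box q (P + 1)) (hB P (by omega)) (by simp [idx])
      (by simp [idx, hpq.symm]) (by simp [hpq]) (fun t ht ht' => by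
        rcases t with ⟨c, i⟩ | h
        · have := hbox c i
          simp only [box_mem_rowEdge, idx, Finset.mem_union] at ht ht'
          grind
        · have := hext h
          simp only [ext_mem_rowEdge, Finset.mem_union] at ht ht'
          grind)
    refine ⟨_, h2, ?_, ?_⟩
    · intro c i hci
      have := hbox c i
      simp only [box_mem_rowEdge, idx, Finset.mem_union] at hci
      grind
    · intro h hh
      have := hext h
      simp only [ext_mem_rowEdge, Finset.mem_union] at hh
      grind

theorem exists_alternating_walk_succ (hpq : p ≠ q)
    (hA : ∀ i ≤ P, rowEdge (idx p q i i (2 * i)) (2 * i) ∈ G)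
    (hB : ∀ i < P, rowEdge (idx p q i (i + 1) (2 * i + 1)) (2 * i + 1) ∈ G) :
    ∃ U, LinearWalk G (box q 0) (box p P) (2 * P + 1) U ∧
      (∀ c i, box c i ∈ U → (c = p → i ≤ P) ∧ (c = q → i ≤ P) ∧ (c ≠ p → c ≠ q → i ≤ 2 * P)) ∧
      ∀ h, ext h ∈ U → h ≤ 2 * P := by
  obtain ⟨U, hU, hbox, hext⟩ := exists_alternating_walk hpq (fun i hi => hA i hi.le) hB
  have h1 := hU.snoc (w := box p P) (hA P le_rfl) (by simp [idx, hpq.symm])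
    (by simp [idx]) (by simp [hpq.symm]) (fun t ht ht' => by
      rcases t with ⟨c, i⟩ | h
      · have := hbox c i ht
        simp only [box_mem_rowEdge, idx] at ht'
        grind
      · have := hext h ht
        simp only [ext_mem_rowEdge] at ht'
        omega)
  refine ⟨_, h1, ?_, ?_⟩
  · intro c i hci
    have := hbox c i
    simp only [box_mem_rowEdge, idx, Finset.mem_union] at hci
    grind
  · intro h hh
    have := hext h
    simp only [ext_mem_rowEdge, Finset.mem_union] at hh
    grind

/-- Closing an alternating walk by one edge. -/
theorem hasClosedWalk_alternating (hpq : p ≠ q)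
    (hA : ∀ i ≤ P, rowEdge (idx p q i i (2 * i)) (2 * i) ∈ G)
    (hB : ∀ i < P, rowEdge (idx p q i (i + 1) (2 * i + 1)) (2 * i + 1) ∈ G)
    (hC : rowEdge (idx p q P 0 (2 * P + 1)) (2 * P + 1) ∈ G) :
    HasClosedWalk G (2 * P + 2) := by
  obtain ⟨U, hU, hbox, hext⟩ := exists_alternating_walk_succ hpq hA hB
  refine ⟨_, _, _, _, _, _, by simp [hpq.symm], hU, LinearWalk.single hC (by simp [idx])
    (by simp [idx, hpq.symm]) (by simp [hpq]), fun t ht ht' => ?_, rfl⟩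
  rcases t with ⟨c, i⟩ | h
  · have := hbox c i ht
    simp only [box_mem_rowEdge, idx] at ht'
    simp only [box.injEq]
    grind
  · have := hext h ht
    simp only [ext_mem_rowEdge] at ht'
    omega

/-- Closing an alternating walk by three edges, two of which share an extension vertex. -/
theorem hasClosedWalk_alternating_three (hpq : p ≠ q) {a b : ℕ} (ha : 2 * P < a)
    (hb : 2 * P < b) (hab : a ≠ b)
    (hA : ∀ i ≤ P, rowEdge (idx p q i i (2 * i)) (2 * i) ∈ G)
    (hB : ∀ i < P, rowEdge (idx p q i (i + 1) (2 * i + 1)) (2 * i + 1) ∈ G)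
    (h₁ : rowEdge (idx p q P (P + 1) (2 * P + 1)) a ∈ G)
    (h₂ : rowEdge (idx p q (P + 1) (P + 2) (2 * P + 2)) a ∈ G)
    (h₃ : rowEdge (idx p q (P + 1) 0 (2 * P + 3)) b ∈ G) :
    HasClosedWalk G (2 * P + 4) := by
  obtain ⟨U, hU, hbox, hext⟩ := exists_alternating_walk_succ hpq hA hB
  have w₃ := LinearWalk.single (u := box p (P + 1)) (v := box q 0) h₃ (by simp [idx])
    (by simp [idx, hpq.symm]) (by simp [hpq])
  have w₂ := LinearWalk.cons (u := ext a) h₂ (by simp) (by simp [idx]) (by simp)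
    (fun t ht ht' => by
      rcases t with ⟨c, i⟩ | h
      · simp only [box_mem_rowEdge, idx] at ht ht'
        grind
      · simp only [ext_mem_rowEdge] at ht ht'
        grind) w₃
  have w₁ := LinearWalk.cons (u := box p P) h₁ (by simp [idx]) (by simp) (by simp)
    (fun t ht ht' => by
      rcases t with ⟨c, i⟩ | h
      · simp only [box_mem_rowEdge, idx, Finset.mem_union] at ht ht'
        grind
      · simp only [ext_mem_rowEdge, Finset.mem_union] at ht ht'
        grind) w₂
  refine ⟨_, _, _, _, _, _, by simp [hpq.symm], hU, w₁, fun t ht ht' => ?_, by omega⟩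
  rcases t with ⟨c, i⟩ | h
  · have := hbox c i ht
    simp only [box_mem_rowEdge, idx, Finset.mem_union] at ht'
    simp only [box.injEq]
    grind
  · have := hext h ht
    simp only [ext_mem_rowEdge, Finset.mem_union] at ht'
    omega

/-- Closing an alternating walk by two edges through the extension vertex of the closing row. -/
theorem hasClosedWalk_alternating_refill (hpq : p ≠ q)
    (hA : ∀ i ≤ P, rowEdge (idx p q i i (2 * i)) (2 * i) ∈ G)
    (hB : ∀ i < P, rowEdge (idx p q i (i + 1) (2 * i + 1)) (2 * i + 1) ∈ G)
    (h₁ : rowEdge (idx p q P (P + 1) (2 * P + 2)) (2 * P + 1) ∈ G)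
    (h₂ : insert (ext (2 * P + 2)) ((rowEdge (idx p q P 0 (2 * P + 1)) (2 * P + 1)).erase
      (box p P)) ∈ G) :
    HasClosedWalk G (2 * P + 3) := by
  obtain ⟨U, hU, hbox, hext⟩ := exists_alternating_walk_succ hpq hA hB
  have w₂ := LinearWalk.single (u := ext (2 * P + 1)) (v := box q 0) h₂ (by simp)
    (by simp [idx, hpq.symm]) (by simp)
  have w₁ := LinearWalk.cons (u := box p P) h₁ (by simp [idx]) (by simp) (by simp)
    (fun t ht ht' => by
      rcases t with ⟨c, i⟩ | h
      · simp only [box_mem_rowEdge, idx, Finset.mem_insert, Finset.mem_erase, reduceCtorEq]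
          at ht ht'
        grind
      · simp only [ext_mem_rowEdge, Finset.mem_insert, Finset.mem_erase, ext.injEq] at ht ht'
        grind) w₂
  refine ⟨_, _, _, _, _, _, by simp [hpq.symm], hU, w₁, fun t ht ht' => ?_, by omega⟩
  rcases t with ⟨c, i⟩ | h
  · have := hbox c i ht
    simp only [box_mem_rowEdge, idx, Finset.mem_insert, Finset.mem_erase, reduceCtorEq,
      box.injEq, Finset.mem_union] at ht' ⊢
    grind
  · have := hext h ht
    simp only [ext_mem_rowEdge, Finset.mem_insert, Finset.mem_erase, ext.injEq,
      Finset.mem_union] at ht'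
    omega

/-- In dimension two, closing an alternating walk by two edges obtained from the closing edge by
replacing one of its vertices. -/
theorem hasClosedWalk_alternating_replace (hpq : p ≠ q) (hs : ∀ c, c = p ∨ c = q)
    (hA : ∀ i ≤ P, rowEdge (idx p q i i (2 * i)) (2 * i) ∈ G)
    (hB : ∀ i < P, rowEdge (idx p q i (i + 1) (2 * i + 1)) (2 * i + 1) ∈ G)
    (h₁ : insert (ext (2 * P + 2)) ((rowEdge (idx p q P 0 (2 * P + 1)) (2 * P + 1)).erase
      (box q 0)) ∈ G)
    (h₂ : insert (ext (2 * P + 3)) ((rowEdge (idx p q P 0 (2 * P + 1)) (2 * P + 1)).erase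
      (box p P)) ∈ G) :
    HasClosedWalk G (2 * P + 3) := by
  obtain ⟨U, hU, hbox, hext⟩ := exists_alternating_walk_succ hpq hA hB
  have w₂ := LinearWalk.single (u := ext (2 * P + 1)) (v := box q 0) h₂ (by simp)
    (by simp [idx, hpq.symm]) (by simp)
  have w₁ := LinearWalk.cons (u := box p P) h₁ (by simp [idx, hpq]) (by simp) (by simp)
    (fun t ht ht' => by
      rcases t with ⟨c, i⟩ | h
      · have := hs c
        simp only [box_mem_rowEdge, idx, Finset.mem_insert, Finset.mem_erase, reduceCtorEq]
          at ht ht'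
        grind
      · simp only [ext_mem_rowEdge, Finset.mem_insert, Finset.mem_erase, ext.injEq] at ht ht'
        grind) w₂
  refine ⟨_, _, _, _, _, _, by simp [hpq.symm], hU, w₁, fun t ht ht' => ?_, by omega⟩
  rcases t with ⟨c, i⟩ | h
  · have := hbox c i ht
    simp only [box_mem_rowEdge, idx, Finset.mem_insert, Finset.mem_erase, reduceCtorEq,
      box.injEq, Finset.mem_union] at ht' ⊢
    grind
  · have := hext h ht
    simp only [ext_mem_rowEdge, Finset.mem_insert, Finset.mem_erase, ext.injEq,
      Finset.mem_union] at ht'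
    omega

/-- In dimension at least three, closing an alternating walk by two edges sharing a vertex in a
third coordinate `o`. -/
theorem hasClosedWalk_alternating_third (hpq : p ≠ q) {o : Fin s} (hop : o ≠ p) (hoq : o ≠ q)
    (hA : ∀ i ≤ P, rowEdge (idx p q i i (2 * i)) (2 * i) ∈ G)
    (hB : ∀ i < P, rowEdge (idx p q i (i + 1) (2 * i + 1)) (2 * i + 1) ∈ G)
    (h₁ : rowEdge (idx p q P (P + 1) (2 * P + 1)) (2 * P + 1) ∈ G)
    (h₂ : rowEdge (Function.update (idx p q (P + 1) 0 (2 * P + 2)) o (2 * P + 1))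
      (2 * P + 2) ∈ G) :
    HasClosedWalk G (2 * P + 3) := by
  obtain ⟨U, hU, hbox, hext⟩ := exists_alternating_walk_succ hpq hA hB
  have w₂ := LinearWalk.single (u := box o (2 * P + 1)) (v := box q 0) h₂ (by simp)
    (by simp [idx, hpq.symm, hoq.symm]) (by simp [hoq])
  have w₁ := LinearWalk.cons (u := box p P) h₁ (by simp [idx]) (by simp [idx, hop, hoq])
    (by simp [hop.symm])
    (fun t ht ht' => by
      rcases t with ⟨c, i⟩ | h
      · simp only [box_mem_rowEdge, idx, Function.update_apply, box.injEq] at ht ht' ⊢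
        grind
      · simp only [ext_mem_rowEdge] at ht ht'
        grind) w₂
  refine ⟨_, _, _, _, _, _, by simp [hpq.symm], hU, w₁, fun t ht ht' => ?_, by omega⟩
  rcases t with ⟨c, i⟩ | h
  · have := hbox c i ht
    simp only [box_mem_rowEdge, idx, Function.update_apply,
      box.injEq, Finset.mem_union] at ht' ⊢
    grind
  · have := hext h ht
    simp only [ext_mem_rowEdge, Finset.mem_union] at ht'
    omega

/-- Walks in which every second connecting vertex is an extension vertex `ext (a i)`. -/
theorem exists_constant_walk (hpq : p ≠ q) {a : ℕ → ℕ} (ha : Function.Injective a)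
    (hA : ∀ i < P, rowEdge (idx p q (2 * i) i (2 * i)) (a i) ∈ G)
    (hB : ∀ i < P, rowEdge (idx p q (2 * i + 1) (i + 1) (2 * i + 1)) (a i) ∈ G) :
    ∃ U, LinearWalk G (box q 0) (box q P) (2 * P) U ∧
      (∀ c i, box c i ∈ U → (c = q → i ≤ P) ∧ (c ≠ q → i < 2 * P)) ∧
      ∀ h, ext h ∈ U → ∃ i < P, h = a i := by
  induction P with
  | zero =>
    refine ⟨_, LinearWalk.nil _, ?_, ?_⟩
    · intro c i hci
      obtain ⟨rfl, rfl⟩ : c = q ∧ i = 0 := by simpa using hci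
      simp
    · simp
  | succ P ih =>
    obtain ⟨U, hU, hbox, hext⟩ := ih (fun i hi => hA i (by omega)) (fun i hi => hB i (by omega))
    have hext' : ext (a P) ∉ U := fun h => by
      obtain ⟨i, hi, h⟩ := hext _ h
      have := ha h
      omega
    have h1 := hU.snoc (w := ext (a P)) (hA P (by omega)) (by simp [idx, hpq.symm])
      (by simp) (by simp) (fun t ht ht' => by
        rcases t with ⟨c, i⟩ | h
        · have := hbox c i ht
          simp only [box_mem_rowEdge, idx] at ht'
          grind
        · simp only [ext_mem_rowEdge] at ht'
          subst ht'
          exact absurd ht hext')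
    have h2 := h1.snoc (w := box q (P + 1)) (hB P (by omega)) (by simp)
      (by simp [idx, hpq.symm]) (by simp) (fun t ht ht' => by
        rcases t with ⟨c, i⟩ | h
        · have := hbox c i
          simp only [box_mem_rowEdge, idx, Finset.mem_union] at ht ht'
          grind
        · simp only [ext_mem_rowEdge] at ht'
          rw [ht'])
    refine ⟨_, h2, ?_, ?_⟩
    · intro c i hci
      have := hbox c i
      simp only [box_mem_rowEdge, idx, Finset.mem_union] at hci
      grind
    · intro h hh
      simp only [ext_mem_rowEdge, Finset.mem_union] at hh
      rcases hh with (hh | hh) | hh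
      · obtain ⟨i, hi, h⟩ := hext h hh
        exact ⟨i, by omega, h⟩
      · exact ⟨P, by omega, hh⟩
      · exact ⟨P, by omega, hh⟩

/-- The extra extension vertex `a P` joins the last two edges back to the start, so `P + 1` constant
vertices yield `2 (P + 1)` edges. `1 ≤ P` keeps the two ends of the first walk apart. -/
theorem hasClosedWalk_constant (hpq : p ≠ q) (hP : 1 ≤ P) {a : ℕ → ℕ} (ha : Function.Injective a)
    {m : ℕ} (hm : 2 * P + 3 < m)
    (hG : ∀ i j t, i < m → j < m → t < m → ∀ h ≤ P, rowEdge (idx p q i j t) (a h) ∈ G) :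
    HasClosedWalk G (2 * P + 2) := by
  obtain ⟨U, hU, hbox, hext⟩ := exists_constant_walk (G := G) (P := P) hpq ha
    (fun i hi => hG _ _ _ (by omega) (by omega) (by omega) _ hi.le)
    (fun i hi => hG _ _ _ (by omega) (by omega) (by omega) _ hi.le)
  have hext' : ext (a P) ∉ U := fun h => by
    obtain ⟨i, hi, h⟩ := hext _ h
    have := ha h
    omega
  have h₁ := hG (2 * P) P (2 * P) (by omega) (by omega) (by omega) P le_rfl
  have h₂ := hG (2 * P + 1) 0 (2 * P + 1) (by omega) (by omega) (by omega) P le_rfl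
  have w₂ := LinearWalk.single (u := ext (a P)) (v := box q 0) h₂ (by simp)
    (by simp [idx, hpq.symm]) (by simp)
  have w₁ := LinearWalk.cons (u := box q P) h₁ (by simp [idx, hpq.symm]) (by simp) (by simp)
    (fun t ht ht' => by
      rcases t with ⟨c, i⟩ | h
      · simp only [box_mem_rowEdge, idx] at ht ht'
        grind
      · simp only [ext_mem_rowEdge] at ht ht'
        grind) w₂
  refine ⟨_, _, _, _, _, _, by simp; omega, hU, w₁, fun t ht ht' => ?_, by omega⟩
  rcases t with ⟨c, i⟩ | h
  · have := hbox c i ht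
    simp only [box_mem_rowEdge, idx, Finset.mem_union] at ht'
    simp only [box.injEq]
    grind
  · simp only [ext_mem_rowEdge, Finset.mem_union, or_self] at ht'
    subst ht'
    exact absurd ht hext'

/-- The return runs `box q P`, `box p (2 * P)`, `ext (a P)`, `box q 0`; the edge through `z`
supplies the odd one. -/
theorem hasClosedWalk_constant_odd (hpq : p ≠ q) (hP : 1 ≤ P) {a : ℕ → ℕ}
    (ha : Function.Injective a) {z : ℕ} (hz : ∀ i, z ≠ a i ∨ P < i) {m : ℕ} (hm : 2 * P + 3 < m)
    (hG : ∀ i j t, i < m → j < m → t < m → ∀ h ≤ P, rowEdge (idx p q i j t) (a h) ∈ G)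
    (hGz : rowEdge (idx p q (2 * P) P (2 * P)) z ∈ G) :
    HasClosedWalk G (2 * P + 3) := by
  obtain ⟨U, hU, hbox, hext⟩ := exists_constant_walk (G := G) (P := P) hpq ha
    (fun i hi => hG _ _ _ (by omega) (by omega) (by omega) _ hi.le)
    (fun i hi => hG _ _ _ (by omega) (by omega) (by omega) _ hi.le)
  have hext' : ext (a P) ∉ U := fun h => by
    obtain ⟨i, hi, h⟩ := hext _ h
    have := ha h
    omega
  have hextz : ext z ∉ U := fun h => by
    obtain ⟨i, hi, h⟩ := hext _ h
    have := hz i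
    omega
  have hzP : z ≠ a P := by
    have := hz P
    omega
  have h₂ := hG (2 * P) (P + 1) (2 * P + 1) (by omega) (by omega) (by omega) P le_rfl
  have h₃ := hG (2 * P + 1) 0 (2 * P + 2) (by omega) (by omega) (by omega) P le_rfl
  have w₃ := LinearWalk.single (u := ext (a P)) (v := box q 0) h₃ (by simp)
    (by simp [idx, hpq.symm]) (by simp)
  have w₂ := LinearWalk.cons (u := box p (2 * P)) h₂ (by simp [idx]) (by simp) (by simp)
    (fun t ht ht' => by
      rcases t with ⟨c, i⟩ | h
      · simp only [box_mem_rowEdge, idx] at ht ht'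
        grind
      · simp only [ext_mem_rowEdge] at ht ht'
        grind) w₃
  have w₁ := LinearWalk.cons (u := box q P) hGz (by simp [idx, hpq.symm]) (by simp [idx])
    (by simp [hpq.symm])
    (fun t ht ht' => by
      rcases t with ⟨c, i⟩ | h
      · simp only [box_mem_rowEdge, idx, Finset.mem_union] at ht ht'
        grind
      · simp only [ext_mem_rowEdge, Finset.mem_union] at ht ht'
        grind) w₂
  refine ⟨_, _, _, _, _, _, by simp; omega, hU, w₁, fun t ht ht' => ?_, by omega⟩
  rcases t with ⟨c, i⟩ | h
  · have := hbox c i ht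
    simp only [box_mem_rowEdge, idx, Finset.mem_union] at ht'
    simp only [box.injEq]
    grind
  · simp only [ext_mem_rowEdge, Finset.mem_union, or_self] at ht'
    rcases ht' with rfl | rfl
    · exact absurd ht hextz
    · exact absurd ht hext'

/-- One edge is added at each end of the constant walk, starting and finishing at the new extension
vertices `z` and `z'`. -/
theorem hasWalk_constant (hpq : p ≠ q) {a : ℕ → ℕ} (ha : Function.Injective a) {z z' : ℕ}
    (hz : ∀ i, z ≠ a i) (hz' : ∀ i, z' ≠ a i) (hzz' : z ≠ z')
    (hA : ∀ i < P, rowEdge (idx p q (2 * i) i (2 * i)) (a i) ∈ G)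
    (hB : ∀ i < P, rowEdge (idx p q (2 * i + 1) (i + 1) (2 * i + 1)) (a i) ∈ G)
    (h₁ : rowEdge (idx p q (2 * P) 0 (2 * P)) z ∈ G)
    (h₂ : rowEdge (idx p q (2 * P + 1) P (2 * P + 1)) z' ∈ G) :
    HasWalk G (2 * P + 2) := by
  obtain ⟨U, hU, hbox, hext⟩ := exists_constant_walk (G := G) (P := P) hpq ha hA hB
  have hextz : ext z ∉ U := fun h => by
    obtain ⟨i, hi, h⟩ := hext _ h
    exact hz i h
  have hextz' : ext z' ∉ U := fun h => by
    obtain ⟨i, hi, h⟩ := hext _ h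
    exact hz' i h
  have w₁ := hU.cons (u := ext z) h₁ (by simp) (by simp [idx, hpq.symm]) (by simp)
    (fun t ht ht' => by
      rcases t with ⟨c, i⟩ | h
      · have := hbox c i ht'
        simp only [box_mem_rowEdge, idx] at ht
        grind
      · simp only [ext_mem_rowEdge] at ht
        subst ht
        exact absurd ht' hextz)
  have w₂ := w₁.snoc (w := ext z') h₂ (by simp [idx, hpq.symm]) (by simp) (by simp)
    (fun t ht ht' => by
      rcases t with ⟨c, i⟩ | h
      · have := hbox c i
        simp only [box_mem_rowEdge, idx, Finset.mem_union] at ht ht'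
        grind
      · simp only [ext_mem_rowEdge, Finset.mem_union] at ht ht'
        subst ht'
        rcases ht with ht | ht
        · exact absurd ht.symm hzz'
        · exact absurd ht hextz')
  exact ⟨_, _, _, w₂⟩

end Tag

/-! ### Realising abstract configurations in a hypergraph -/

namespace Tag

variable {V : Type*} {s : ℕ}

/-- Interpretation of tags as vertices. -/
def interp (x : Fin s → ℕ → V) (e : ℕ → V) : Tag s → V
  | box c i => x c i
  | ext h => e h

/-- The tags with box indices below `m` and extension indices in `W`. -/
def support (s m : ℕ) (W : Set ℕ) : Set (Tag s)
  | box _ i => i < m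
  | ext h => h ∈ W

variable {x : Fin s → ℕ → V} {e : ℕ → V} {m : ℕ} {W : Set ℕ}

theorem interp_injOn (hx : ∀ j j' i i', i < m → i' < m → x j i = x j' i' → j = j' ∧ i = i')
    (he : ∀ h ∈ W, ∀ h' ∈ W, e h = e h' → h = h') (hxe : ∀ h ∈ W, ∀ j i, i < m → e h ≠ x j i) :
    Set.InjOn (interp x e) (support s m W) := by
  rintro (⟨c, i⟩ | h) ha (⟨c', i'⟩ | h') hb hab
  · obtain ⟨rfl, rfl⟩ := hx c c' i i' ha hb hab
    rfl
  · exact absurd hab.symm (hxe h' hb c i ha)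
  · exact absurd hab (hxe h ha c' i' hb)
  · rw [he h ha h' hb hab]

variable [DecidableEq V]

/-- The sets of admissible tags whose interpretation is an edge of `H`. -/
def pullback (H : Finset (Finset V)) (x : Fin s → ℕ → V) (e : ℕ → V) (m : ℕ) (W : Set ℕ) :
    Set (Finset (Tag s)) :=
  {E | (E : Set (Tag s)) ⊆ support s m W ∧ E.image (interp x e) ∈ H}

variable {H : Finset (Finset V)}

theorem rowEdge_subset_support {ι : Fin s → ℕ} {h : ℕ} (hι : ∀ j, ι j < m) (hh : h ∈ W) :
    (rowEdge ι h : Set (Tag s)) ⊆ support s m W := by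
  rintro (⟨c, i⟩ | k) ht
  · have := box_mem_rowEdge.1 (Finset.mem_coe.1 ht)
    subst this
    exact hι c
  · have := ext_mem_rowEdge.1 (Finset.mem_coe.1 ht)
    subst this
    exact hh

theorem image_rowEdge (x : Fin s → ℕ → V) (e : ℕ → V) (ι : Fin s → ℕ) (h : ℕ) :
    (rowEdge ι h).image (interp x e) = insert (e h) (Finset.univ.image (row x ι)) := by
  rw [rowEdge, Finset.image_insert, Finset.image_image]
  rfl

theorem rowEdge_mem_pullback {ι : Fin s → ℕ} {h : ℕ} (hι : ∀ j, ι j < m) (hh : h ∈ W)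
    (hH : insert (e h) (Finset.univ.image (row x ι)) ∈ H) : rowEdge ι h ∈ pullback H x e m W :=
  ⟨rowEdge_subset_support hι hh, by rwa [image_rowEdge]⟩

/-- Injectivity is needed because taking images commutes with erasing a point only if no other point
has the same image. -/
theorem insert_erase_mem_pullback (hinj : Set.InjOn (interp x e) (support s m W)) {ι : Fin s → ℕ}
    {h a : ℕ} (hι : ∀ j, ι j < m) (hh : h ∈ W) (ha : a ∈ W) {c : Fin s} {i : ℕ} (hi : ι c = i)
    (hH : insert (e a) ((insert (e h) (Finset.univ.image (row x ι))).erase (row x ι c)) ∈ H) :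
    insert (ext a) ((rowEdge ι h).erase (box c i)) ∈ pullback H x e m W := by
  subst hi
  have hsub := rowEdge_subset_support (s := s) hι hh
  constructor
  · rw [Finset.coe_insert, Set.insert_subset_iff]
    exact ⟨ha, (Finset.coe_subset.2 (Finset.erase_subset _ _)).trans hsub⟩
  · have himage : ((rowEdge ι h).erase (box c (ι c))).image (interp x e) =
        (insert (e h) (Finset.univ.image (row x ι))).erase (row x ι c) := by
      rw [← image_rowEdge]
      ext v
      simp only [Finset.mem_image, Finset.mem_erase]
      constructor
      · rintro ⟨t, ⟨ht, ht'⟩, rfl⟩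
        refine ⟨fun hc => ht (hinj (hsub ht') (hι c) hc), t, ht', rfl⟩
      · rintro ⟨hv, t, ht, rfl⟩
        exact ⟨t, ⟨fun hc => hv (by rw [hc]; rfl), ht⟩, rfl⟩
    rw [Finset.image_insert, himage]
    exact hH

theorem hasWalk_of_pullback (hinj : Set.InjOn (interp x e) (support s m W)) {n : ℕ}
    (h : HasWalk (pullback H x e m W) (n + 1)) : HasWalk (H : Set (Finset V)) (n + 1) :=
  h.map hinj (fun _ hE => hE.1) (fun _ hE => hE.2)

theorem hasClosedWalk_of_pullback (hinj : Set.InjOn (interp x e) (support s m W)) {n : ℕ}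
    (h : HasClosedWalk (pullback H x e m W) n) : HasClosedWalk (H : Set (Finset V)) n :=
  h.map hinj (fun _ hE => hE.1) (fun _ hE => hE.2)

end Tag

/-! ### Cases with at least `l` constant extension functions -/

/-- `H` contains linear walks with `2 l + 2` edges, closed ones too, and closed walks with
`2 l + 1` edges if `2 ≤ l`. -/
def HasConfigurations {V : Type*} [DecidableEq V] (H : Finset (Finset V)) (l : ℕ) : Prop :=
  HasWalk (H : Set (Finset V)) (2 * l + 2) ∧ HasClosedWalk (H : Set (Finset V)) (2 * l + 2) ∧
    (2 ≤ l → HasClosedWalk (H : Set (Finset V)) (2 * l + 1))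

open Tag

theorem idx_lt {s m : ℕ} {p q : Fin s} {i j t : ℕ} (hi : i < m) (hj : j < m) (ht : t < m)
    (c : Fin s) : idx p q i j t c < m := by
  unfold idx
  split_ifs <;> assumption

theorem hasConfigurations_of_constants {s l : ℕ} (hs : 2 ≤ s) (hl : 1 ≤ l) {θ : ℝ} (hθ : 0 < θ) :
    ∃ N : ℕ, ∀ (V : Type*) [Fintype V] [DecidableEq V], N ≤ Fintype.card V →
      ∀ (H : Finset (Finset V)) (D : Finset (Fin s → V)),
      θ * (Fintype.card V : ℝ) ^ s ≤ D.card → (∀ S ∈ D, Function.Injective S) →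
      ∀ a : Fin (l + 1) → V, Function.Injective a →
      (∀ c, ∀ S ∈ D, (∀ j, a c ≠ S j) ∧ insert (a c) (Finset.univ.image S) ∈ H) →
      HasConfigurations H l := by
  -- The side `2 * l + 20` only has to exceed every index used in the walks.
  obtain ⟨η, hη, N, hbox⟩ := exists_separated_box s (2 * l + 20) (by omega) hθ (Fin (l + 1))
  refine ⟨N, fun V _ _ hV H D hD hinj a ha haH => ?_⟩
  obtain ⟨x, hx, hxinj, hxa, -⟩ := hbox V hV D hD hinj (fun c _ => a c)
    (fun c S hS => (haH c S hS).1)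
  let e : ℕ → V := fun h => if hh : h < l + 1 then a ⟨h, hh⟩ else a 0
  have heq : ∀ h (hh : h < l + 1), e h = a ⟨h, hh⟩ := fun h hh => dif_pos hh
  let p : Fin s := ⟨0, by omega⟩
  let q : Fin s := ⟨1, by omega⟩
  have hpq : p ≠ q := by simp [p, q]
  have hev : Set.InjOn (interp x e) (support s (2 * l + 20) {h | h < l + 1}) := by
    refine interp_injOn hxinj (fun h hh h' hh' hhh => ?_) fun h hh j i hi => ?_
    · rw [heq h hh, heq h' hh'] at hhh
      simpa using ha hhh
    · rw [heq h hh]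
      exact hxa ⟨h, hh⟩ (fun _ => 0) (fun _ => by omega) j i hi
  have hG : ∀ i j t, i < 2 * l + 20 → j < 2 * l + 20 → t < 2 * l + 20 → ∀ h < l + 1,
      rowEdge (idx p q i j t) h ∈ pullback H x e (2 * l + 20) {h | h < l + 1} := by
    intro i j t hi hj ht h hh
    refine rowEdge_mem_pullback (idx_lt hi hj ht) hh ?_
    rw [heq h hh]
    exact (haH _ _ (hx _ (idx_lt hi hj ht))).2
  refine ⟨hasWalk_of_pullback hev ?_, hasClosedWalk_of_pullback hev ?_, fun hl2 =>
    hasClosedWalk_of_pullback hev ?_⟩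
  · obtain ⟨U, hU, -⟩ := exists_constant_walk (P := l + 1) hpq (a := id) Function.injective_id
      (fun i hi => hG _ _ _ (by omega) (by omega) (by omega) _ hi)
      (fun i hi => hG _ _ _ (by omega) (by omega) (by omega) _ hi)
    exact ⟨_, _, _, hU⟩
  · exact hasClosedWalk_constant hpq hl (a := id) Function.injective_id
      (m := 2 * l + 20) (by omega) fun i j t hi hj ht h hh => hG i j t hi hj ht h (by simpa using by omega)
  · obtain ⟨P, rfl⟩ : ∃ P, l = P + 1 := ⟨l - 1, by omega⟩
    exact hasClosedWalk_constant_odd (P := P) (z := P + 1) hpq (by omega) (a := id)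
      Function.injective_id (fun i => by simp only [id]; omega) (m := 2 * (P + 1) + 20) (by omega)
      (fun i j t hi hj ht h hh => hG i j t hi hj ht h (by omega))
      (hG _ _ _ (by omega) (by omega) (by omega) _ (by omega))

/-- The `l` constants do most of the work; one or two edges extended by `f` replace the missing
constant, except in the even cycle, where `f` extends every second edge of an alternating walk and
the last constant joins two closing edges. -/
theorem hasConfigurations_of_constants_of_coordinate {s l : ℕ} (hs : 2 ≤ s) (hl : 1 ≤ l) {θ : ℝ}
    (hθ : 0 < θ) : ∃ η : ℝ, 0 < η ∧
    ∃ N : ℕ, ∀ (V : Type*) [Fintype V] [DecidableEq V], N ≤ Fintype.card V →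
      ∀ (H : Finset (Finset V)) (D : Finset (Fin s → V)),
      θ * (Fintype.card V : ℝ) ^ s ≤ D.card → (∀ S ∈ D, Function.Injective S) →
      ∀ a : Fin l → V, Function.Injective a →
      (∀ c, ∀ S ∈ D, (∀ j, a c ≠ S j) ∧ insert (a c) (Finset.univ.image S) ∈ H) →
      ∀ (f : (Fin s → V) → V) (p : Fin s),
      (∀ S ∈ D, (∀ j, f S ≠ S j) ∧ insert (f S) (Finset.univ.image S) ∈ H) →
      (∀ c, ∀ S ∈ D, a c ≠ f S) → (∀ S ∈ D, ∀ S' ∈ D, S p = S' p → f S = f S') →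
      Spread D f ∅ η → HasConfigurations H l := by
  obtain ⟨η, hη, N, hbox⟩ := exists_separated_box s (2 * l + 20) (by omega) hθ (Option (Fin l))
  refine ⟨η, hη, N, fun V _ _ hV H D hD hinj a ha haH f p hf haf hfp hsp => ?_⟩
  obtain ⟨x, hx, hxinj, hxF, hsep⟩ := hbox V hV D hD hinj
    (fun c => c.elim f fun c _ => a c) (by
      rintro (_ | c) S hS
      · exact (hf S hS).1
      · exact (haH c S hS).1)
  let z : ℕ → V := fun i => f (row x fun _ => i)
  -- Even tags are values of `f`, labelled by the index in coordinate `p`; odd tags are the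
  -- constants.
  let e : ℕ → V := fun h => if h % 2 = 0 then z (h / 2) else
    if hh : h / 2 < l then a ⟨h / 2, hh⟩ else z 0
  let W : Set ℕ := {h | h / 2 < 2 * l + 20 ∧ (h % 2 = 1 → h / 2 < l)}
  have hez : ∀ i, e (2 * i) = z i := fun i => by
    simp only [e]
    rw [if_pos (by omega), Nat.mul_div_cancel_left _ (by omega)]
  have hea : ∀ i (hi : i < l), e (2 * i + 1) = a ⟨i, hi⟩ := fun i hi => by
    simp only [e]
    have h2 : (2 * i + 1) / 2 = i := by omega
    rw [if_neg (by omega), dif_pos (by omega)]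
    simp only [h2]
  have hzW : ∀ i, i < 2 * l + 20 → 2 * i ∈ W := fun i hi => by
    simp only [W, Set.mem_ofPred_eq]; omega
  have haW : ∀ i, i < l → 2 * i + 1 ∈ W := fun i hi => by
    simp only [W, Set.mem_ofPred_eq]; omega
  have hWcases : ∀ h ∈ W, (∃ i < 2 * l + 20, h = 2 * i) ∨ ∃ i < l, h = 2 * i + 1 := by
    rintro h ⟨h1, h2⟩
    rcases Nat.mod_two_eq_zero_or_one h with h0 | h0
    · exact Or.inl ⟨h / 2, h1, by omega⟩
    · exact Or.inr ⟨h / 2, h2 h0, by omega⟩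
  have hzz : ∀ i < 2 * l + 20, ∀ i' < 2 * l + 20, z i = z i' → i = i' := by
    intro i hi i' hi' h
    by_contra hne
    exact hsep none none ∅ (fun _ => i) (fun _ => i') (fun _ => hi) (fun _ => hi')
      (by simpa using fun _ : Fin s => hne) hsp h
  have haz : ∀ i < 2 * l + 20, ∀ c, a c ≠ z i := fun i hi c => haf c _ (hx _ fun _ => hi)
  have hev : Set.InjOn (interp x e) (support s (2 * l + 20) W) := by
    refine interp_injOn hxinj (fun h hh h' hh' hhh => ?_) fun h hh j i hi => ?_
    · rcases hWcases h hh with ⟨i, hi, rfl⟩ | ⟨i, hi, rfl⟩ <;>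
      rcases hWcases h' hh' with ⟨i', hi', rfl⟩ | ⟨i', hi', rfl⟩
      · rw [hez, hez] at hhh
        rw [hzz i hi i' hi' hhh]
      · rw [hez, hea i' hi'] at hhh
        exact absurd hhh.symm (haz i hi _)
      · rw [hez, hea i hi] at hhh
        exact absurd hhh (haz i' hi' _)
      · rw [hea i hi, hea i' hi'] at hhh
        have := ha hhh
        simp only [Fin.mk.injEq] at this
        rw [this]
    · rcases hWcases h hh with ⟨i', hi', rfl⟩ | ⟨i', hi', rfl⟩
      · rw [hez]
        exact hxF none (fun _ => i') (fun _ => hi') j i hi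
      · rw [hea i' hi']
        exact hxF (some ⟨i', hi'⟩) (fun _ => 0) (fun _ => by omega) j i hi
  obtain ⟨q, hpq⟩ : ∃ q : Fin s, p ≠ q := by
    have : Nontrivial (Fin s) := Fin.nontrivial_iff_two_le.2 hs
    obtain ⟨q, hq⟩ := exists_ne p
    exact ⟨q, hq.symm⟩
  have hGa : ∀ i j t, i < 2 * l + 20 → j < 2 * l + 20 → t < 2 * l + 20 → ∀ h < l,
      rowEdge (idx p q i j t) (2 * h + 1) ∈ pullback H x e (2 * l + 20) W := by
    intro i j t hi hj ht h hh
    refine rowEdge_mem_pullback (idx_lt hi hj ht) (haW h hh) ?_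
    rw [hea h hh]
    exact (haH _ _ (hx _ (idx_lt hi hj ht))).2
  have hGz : ∀ i j t h, i < 2 * l + 20 → j < 2 * l + 20 → t < 2 * l + 20 → h = 2 * i →
      rowEdge (idx p q i j t) h ∈ pullback H x e (2 * l + 20) W := by
    rintro i j t _ hi hj ht rfl
    refine rowEdge_mem_pullback (idx_lt hi hj ht) (hzW i hi) ?_
    have hD' := hx _ (idx_lt (p := p) (q := q) hi hj ht)
    have : z i = f (row x (idx p q i j t)) :=
      hfp _ (hx _ fun _ => hi) _ hD' (by simp [row, idx])
    rw [hez, this]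
    exact (hf _ hD').2
  have hodd : Function.Injective fun i : ℕ => 2 * i + 1 := fun i j hij => by
    simpa using hij
  refine ⟨hasWalk_of_pullback hev ?_, hasClosedWalk_of_pullback hev ?_, fun hl2 =>
    hasClosedWalk_of_pullback hev ?_⟩
  · exact hasWalk_constant hpq hodd (z := 2 * (2 * l)) (z' := 2 * (2 * l + 1))
      (fun i => by omega) (fun i => by omega) (by omega)
      (fun i hi => hGa _ _ _ (by omega) (by omega) (by omega) _ hi)
      (fun i hi => hGa _ _ _ (by omega) (by omega) (by omega) _ hi)
      (hGz _ _ _ _ (by omega) (by omega) (by omega) rfl)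
      (hGz _ _ _ _ (by omega) (by omega) (by omega) rfl)
  · obtain ⟨P, rfl⟩ : ∃ P, l = P + 1 := ⟨l - 1, by omega⟩
    exact hasClosedWalk_alternating_three (P := P) (a := 2 * P + 1) (b := 2 * (P + 1)) hpq
      (by omega) (by omega) (by omega)
      (fun i hi => hGz _ _ _ _ (by omega) (by omega) (by omega) rfl)
      (fun i hi => hGa _ _ _ (by omega) (by omega) (by omega) _ (by omega))
      (hGa _ _ _ (by omega) (by omega) (by omega) _ (by omega))
      (hGa _ _ _ (by omega) (by omega) (by omega) _ (by omega))
      (hGz _ _ _ _ (by omega) (by omega) (by omega) rfl)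
  · obtain ⟨P, rfl⟩ : ∃ P, l = P + 1 := ⟨l - 1, by omega⟩
    exact hasClosedWalk_constant_odd (P := P) (z := 2 * (2 * P)) hpq (by omega) hodd
      (fun i => Or.inl (by omega)) (m := 2 * (P + 1) + 20) (by omega)
      (fun i j t hi hj ht h hh => hGa i j t hi hj ht h (by omega))
      (hGz _ _ _ _ (by omega) (by omega) (by omega) rfl)

/-! ### A function spread relative to every single coordinate -/

open Tag

/-- The rows used by an alternating closed walk with `2 P + 2` edges. -/
def alternatingRow {s : ℕ} (p q : Fin s) (P h : ℕ) : Fin s → ℕ :=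
  if h % 2 = 0 then idx p q (h / 2) (h / 2) h
  else idx p q (h / 2) (if h / 2 = P then 0 else h / 2 + 1) h

section AlternatingRow

variable {s : ℕ} {p q : Fin s} {P : ℕ}

theorem alternatingRow_even (p q : Fin s) (P i : ℕ) :
    alternatingRow p q P (2 * i) = idx p q i i (2 * i) := by
  have h : 2 * i / 2 = i := by omega
  rw [alternatingRow, if_pos (by omega), h]

theorem alternatingRow_odd (p q : Fin s) (P i : ℕ) :
    alternatingRow p q P (2 * i + 1) = idx p q i (if i = P then 0 else i + 1) (2 * i + 1) := by
  have h : (2 * i + 1) / 2 = i := by omega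
  rw [alternatingRow, if_neg (by omega), h]

theorem alternatingRow_lt {m h : ℕ} (hm : 2 * P + 2 ≤ m) (hh : h < 2 * P + 2) (c : Fin s) :
    alternatingRow p q P h c < m := by
  rcases Nat.even_or_odd' h with ⟨i, rfl | rfl⟩
  · rw [alternatingRow_even]
    exact idx_lt (by omega) (by omega) (by omega) c
  · rw [alternatingRow_odd]
    refine idx_lt (by omega) ?_ (by omega) c
    split_ifs <;> omega

/-- Two distinct rows share at most one coordinate, exactly what spreadness relative to singletons
can handle. -/
theorem alternatingRow_agree (hP : 1 ≤ P) {h h' : ℕ} (hh : h < 2 * P + 2)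
    (hh' : h' < 2 * P + 2) (hne : h ≠ h') {c c' : Fin s}
    (hc : alternatingRow p q P h c = alternatingRow p q P h' c)
    (hc' : alternatingRow p q P h c' = alternatingRow p q P h' c') : c = c' := by
  rcases Nat.even_or_odd' h with ⟨i, rfl | rfl⟩ <;> rcases Nat.even_or_odd' h' with ⟨i', rfl | rfl⟩ <;>
    simp only [alternatingRow_even, alternatingRow_odd, idx] at hc hc' <;> grind

theorem alternatingRow_ne {i i' : ℕ} (hne : i ≠ i') {b : ℕ}
    (hb : b < 2) (c : Fin s) :
    alternatingRow p q P (2 * i + b) c ≠ alternatingRow p q P (2 * i' + b) c := by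
  interval_cases b
  · simp only [add_zero, alternatingRow_even, idx]; grind
  · simp only [alternatingRow_odd, idx]; grind

end AlternatingRow

theorem IsFull.exists_replacement {V : Type*} [Fintype V] [DecidableEq V] {s d : ℕ}
    {H : Finset (Finset V)} (hH : IsRGraph (s + 1) H) (hf : IsFull d H) {E : Finset V} (hE : E ∈ H)
    {v : V} (hv : v ∈ E) {B : Finset V} (hB : B.card + 1 < d) :
    ∃ w, w ∉ E ∧ insert w (E.erase v) ∈ H ∧ w ∉ B := by
  obtain ⟨w, hw, hwH, hwB⟩ := hf.exists_extension hH (Finset.mem_shadow_iff.2 ⟨E, hE, v, hv, rfl⟩)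
    (B := insert v B) (lt_of_le_of_lt (Finset.card_insert_le _ _) hB)
  rw [Finset.mem_insert, not_or] at hwB
  exact ⟨w, fun hwE => hw (Finset.mem_erase.2 ⟨hwB.1, hwE⟩), hwH, hwB.2⟩

/-- Since the rows used pairwise agree in at most one coordinate, the values of `f` on them are
distinct, and alternating walks give the path and the even cycle. The odd cycle needs two closing
edges in place of one: for `s ≥ 3` they meet in a third coordinate, and for `s = 2` fullness
provides them by replacing vertices of the closing edge. -/
theorem hasConfigurations_of_spread {s l : ℕ} (hs : 2 ≤ s) (hl : 1 ≤ l) {θ : ℝ} (hθ : 0 < θ) :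
    ∃ η : ℝ, 0 < η ∧
    ∃ N : ℕ, ∀ (V : Type*) [Fintype V] [DecidableEq V], N ≤ Fintype.card V →
      ∀ H : Finset (Finset V), IsRGraph (s + 1) H → IsFull (l + 1) H → ∀ D : Finset (Fin s → V),
      θ * (Fintype.card V : ℝ) ^ s ≤ D.card → (∀ S ∈ D, Function.Injective S) →
      ∀ f : (Fin s → V) → V,
      (∀ S ∈ D, (∀ j, f S ≠ S j) ∧ insert (f S) (Finset.univ.image S) ∈ H) →
      (∀ j, Spread D f {j} η) → HasConfigurations H l := by
  obtain ⟨η, hη, N, hbox⟩ := exists_separated_box s (2 * l + 20) (by omega) hθ (Fin 3)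
  refine ⟨η, hη, N, fun V _ _ hV H hH hfull D hD hinj f hf hsp => ?_⟩
  let p : Fin s := ⟨0, by omega⟩
  let q : Fin s := ⟨1, by omega⟩
  have hpq : p ≠ q := by simp [p, q]
  -- Codegree at least `l + 1 ≥ 3` leaves room for `w'` to avoid both the replaced vertex and `w`;
  -- for `l = 1` the odd cycle is not required and `f S` is a dummy value.
  have hww : ∀ S : Fin s → V, ∃ w w' : V, S ∈ D → (∀ j, w ≠ S j) ∧ (∀ j, w' ≠ S j) ∧ (2 ≤ l →
      w ≠ f S ∧ w' ≠ f S ∧ w ≠ w' ∧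
      insert w ((insert (f S) (Finset.univ.image S)).erase (S q)) ∈ H ∧
      insert w' ((insert (f S) (Finset.univ.image S)).erase (S p)) ∈ H) := by
    intro S
    by_cases hS : S ∈ D
    · obtain ⟨hfS, hfH⟩ := hf S hS
      by_cases hl2 : 2 ≤ l
      · obtain ⟨w, hw, hwH, -⟩ := hfull.exists_replacement hH hfH (v := S q) (B := ∅) (by simp)
          (by simp; omega)
        obtain ⟨w', hw', hwH', hww'⟩ := hfull.exists_replacement hH hfH (v := S p) (B := {w})
          (by simp) (by simp; omega)
        simp only [Finset.mem_insert, Finset.mem_image, Finset.mem_univ, true_and, not_or,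
          not_exists, Finset.mem_singleton] at hw hw' hww'
        exact ⟨w, w', fun _ => ⟨fun j h => hw.2 j h.symm, fun j h => hw'.2 j h.symm, fun _ =>
          ⟨hw.1, hw'.1, fun h => hww' h.symm, hwH, hwH'⟩⟩⟩
      · exact ⟨f S, f S, fun _ => ⟨hfS, hfS, fun h => absurd h hl2⟩⟩
    · exact ⟨f S, f S, fun h => absurd h hS⟩
  choose w w' hww using hww
  obtain ⟨x, hx, hxinj, hxF, hsep⟩ := hbox V hV D hD hinj ![f, w, w'] (by
    intro c S hS
    fin_cases c
    · exact (hf S hS).1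
    · exact (hww S hS).1
    · exact (hww S hS).2.1)
  have hsep' : ∀ (c : Fin 3) (ι ι' : Fin s → ℕ), (∀ j, ι j < 2 * l + 20) →
      (∀ j, ι' j < 2 * l + 20) → (∀ j j', ι j = ι' j → ι j' = ι' j' → j = j') →
      (![f, w, w'] : Fin 3 → (Fin s → V) → V) c (row x ι) ≠ f (row x ι') := by
    intro c ι ι' hι hι' hagree
    by_cases h : ∃ j, ι j = ι' j
    · obtain ⟨j, hj⟩ := h
      refine hsep c 0 {j} ι ι' hι hι' (fun j' => ?_) (hsp j)
      rw [Finset.mem_singleton]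
      exact ⟨fun h => hagree _ _ h hj, fun h => h ▸ hj⟩
    · refine hsep c 0 ∅ ι ι' hι hι' (fun j' => ?_) ((hsp p).anti subset_rfl (by simp) le_rfl)
      simpa using fun h' => h ⟨j', h'⟩
  have hrows : ∀ (ρ : ℕ → Fin s → ℕ) (M : ℕ), (∀ h < M, ∀ j, ρ h j < 2 * l + 20) →
      (∀ h < M, ∀ h' < M, h ≠ h' → ∀ c c', ρ h c = ρ h' c → ρ h c' = ρ h' c' → c = c') →
      Set.InjOn (interp x fun h => f (row x (ρ h))) (support s (2 * l + 20) {h | h < M}) ∧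
      ∀ h < M, rowEdge (ρ h) h ∈
        pullback H x (fun h => f (row x (ρ h))) (2 * l + 20) {h | h < M} := by
    intro ρ M hρ hagree
    refine ⟨interp_injOn hxinj (fun h hh h' hh' hhh => ?_) fun h hh j i hi =>
      hxF 0 _ (hρ h hh) j i hi, fun h hh =>
        rowEdge_mem_pullback (hρ h hh) hh (hf _ (hx _ (hρ h hh))).2⟩
    by_contra hne
    exact hsep' 0 _ _ (hρ h hh) (hρ h' hh') (hagree h hh h' hh' hne) hhh
  refine ⟨?_, ?_, fun hl2 => ?_⟩
  · obtain ⟨h1, h2⟩ := hrows (alternatingRow p q (l + 1)) (2 * (l + 1) + 2)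
      (fun h hh => alternatingRow_lt (by omega) hh)
      (fun h hh h' hh' hne c c' => alternatingRow_agree (by omega) hh hh' hne)
    refine hasWalk_of_pullback h1 ?_
    obtain ⟨U, hU, -⟩ := exists_alternating_walk (P := l + 1) hpq
      (fun i hi => by
        have := h2 (2 * i) (by omega)
        rwa [alternatingRow_even] at this)
      (fun i hi => by
        have := h2 (2 * i + 1) (by omega)
        rwa [alternatingRow_odd, if_neg (by omega)] at this)
    exact ⟨_, _, _, hU⟩
  · obtain ⟨h1, h2⟩ := hrows (alternatingRow p q l) (2 * l + 2)
      (fun h hh => alternatingRow_lt (by omega) hh)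
      (fun h hh h' hh' hne c c' => alternatingRow_agree hl hh hh' hne)
    refine hasClosedWalk_of_pullback h1 (hasClosedWalk_alternating hpq (fun i hi => ?_)
      (fun i hi => ?_) ?_)
    · have := h2 (2 * i) (by omega)
      rwa [alternatingRow_even] at this
    · have := h2 (2 * i + 1) (by omega)
      rwa [alternatingRow_odd, if_neg (by omega)] at this
    · have := h2 (2 * l + 1) (by omega)
      rwa [alternatingRow_odd, if_pos rfl] at this
  · obtain ⟨P, rfl⟩ : ∃ P, l = P + 1 := ⟨l - 1, by omega⟩
    by_cases hs3 : s = 2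
    · have hcover : ∀ c, c = p ∨ c = q := by
        intro c
        have := c.2
        simp only [p, q, Fin.ext_iff]
        omega
      let S := row x (alternatingRow p q P (2 * P + 1))
      have hlast := alternatingRow_lt (p := p) (q := q) (P := P) (m := 2 * (P + 1) + 20)
        (h := 2 * P + 1) (by omega) (by omega)
      have hSD : S ∈ D := hx _ hlast
      obtain ⟨-, -, hw⟩ := hww S hSD
      obtain ⟨hwf, hwf', hww', hwH, hwH'⟩ := hw hl2
      let e : ℕ → V := fun h => if h = 2 * P + 2 then w S else if h = 2 * P + 3 then w' S else
        f (row x (alternatingRow p q P h))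
      have he : ∀ h, h < 2 * P + 2 → e h = f (row x (alternatingRow p q P h)) := fun h hh => by
        simp only [e]
        rw [if_neg (by omega), if_neg (by omega)]
      have he2 : e (2 * P + 2) = w S := if_pos rfl
      have he3 : e (2 * P + 3) = w' S := by
        simp only [e]
        rw [if_neg (by omega)]
        simp
      have hcases : ∀ h : ℕ, h < 2 * P + 4 → h < 2 * P + 2 ∨ h = 2 * P + 2 ∨ h = 2 * P + 3 :=
        fun h hh => by omega
      have hlow : ∀ h < 2 * P + 2, ∀ j, alternatingRow p q P h j < 2 * (P + 1) + 20 :=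
        fun h hh => alternatingRow_lt (by omega) hh
      have hne : ∀ h < 2 * P + 2, w S ≠ e h ∧ w' S ≠ e h := by
        intro h hh
        rw [he h hh]
        by_cases hh' : h = 2 * P + 1
        · subst hh'
          exact ⟨hwf, hwf'⟩
        · have hag : ∀ j j', alternatingRow p q P (2 * P + 1) j = alternatingRow p q P h j →
              alternatingRow p q P (2 * P + 1) j' = alternatingRow p q P h j' → j = j' :=
            fun j j' => alternatingRow_agree (by omega) (by omega) hh fun h' => hh' h'.symm
          exact ⟨hsep' 1 _ _ hlast (hlow h hh) hag, hsep' 2 _ _ hlast (hlow h hh) hag⟩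
      have hev : Set.InjOn (interp x e) (support s (2 * (P + 1) + 20) {h | h < 2 * P + 4}) := by
        refine interp_injOn hxinj (fun h hh h' hh' hhh => ?_) fun h hh j i hi => ?_
        · by_contra hhne
          rcases hcases h hh with hh | rfl | rfl <;> rcases hcases h' hh' with hh' | rfl | rfl
          · rw [he h hh, he h' hh'] at hhh
            exact hsep' 0 _ _ (hlow h hh) (hlow h' hh')
              (fun j j' => alternatingRow_agree (by omega) hh hh' hhne) hhh
          · exact (hne h hh).1 (hhh.trans he2).symm
          · exact (hne h hh).2 (hhh.trans he3).symm
          · exact (hne h' hh').1 (he2.symm.trans hhh)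
          · exact hhne rfl
          · exact hww' (he2.symm.trans (hhh.trans he3))
          · exact (hne h' hh').2 (he3.symm.trans hhh)
          · exact hww' (he2.symm.trans (hhh.symm.trans he3))
          · exact hhne rfl
        · rcases hcases h hh with hh | rfl | rfl
          · rw [he h hh]; exact hxF 0 _ (hlow h hh) j i hi
          · rw [he2]; exact hxF 1 _ hlast j i hi
          · rw [he3]; exact hxF 2 _ hlast j i hi
      have hG : ∀ h < 2 * P + 2, rowEdge (alternatingRow p q P h) h ∈
          pullback H x e (2 * (P + 1) + 20) {h | h < 2 * P + 4} := fun h hh =>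
        rowEdge_mem_pullback (hlow h hh) (show h < 2 * P + 4 by omega)
          (by rw [he h hh]; exact (hf _ (hx _ (hlow h hh))).2)
      refine hasClosedWalk_of_pullback hev (hasClosedWalk_alternating_replace (P := P) hpq hcover
        (fun i hi => ?_) (fun i hi => ?_) ?_ ?_)
      · have := hG (2 * i) (by omega)
        rwa [alternatingRow_even] at this
      · have := hG (2 * i + 1) (by omega)
        rwa [alternatingRow_odd, if_neg (by omega)] at this
      · have hrow : alternatingRow p q P (2 * P + 1) = idx p q P 0 (2 * P + 1) := by
          rw [alternatingRow_odd, if_pos rfl]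
        rw [← hrow]
        refine insert_erase_mem_pullback hev hlast (show 2 * P + 1 < 2 * P + 4 by omega)
          (show 2 * P + 2 < 2 * P + 4 by omega) (by rw [hrow, idx_right hpq]) ?_
        rw [he2, he _ (by omega)]
        exact hwH
      · have hrow : alternatingRow p q P (2 * P + 1) = idx p q P 0 (2 * P + 1) := by
          rw [alternatingRow_odd, if_pos rfl]
        rw [← hrow]
        refine insert_erase_mem_pullback hev hlast (show 2 * P + 1 < 2 * P + 4 by omega)
          (show 2 * P + 3 < 2 * P + 4 by omega) (by rw [hrow, idx_left]) ?_
        rw [he3, he _ (by omega)]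
        exact hwH'
    · let o : Fin s := ⟨2, by omega⟩
      have hop : o ≠ p := by simp [o, p]
      have hoq : o ≠ q := by simp [o, q]
      let ρ : ℕ → Fin s → ℕ := fun h => if h = 2 * P + 1 then idx p q P (P + 1) (2 * P + 1) else
        if h = 2 * P + 2 then Function.update (idx p q (P + 1) 0 (2 * P + 2)) o (2 * P + 1) else
        alternatingRow p q P h
      have hρ : ∀ h, h ≤ 2 * P → ρ h = alternatingRow p q P h := fun h hh => by
        simp only [ρ]
        rw [if_neg (by omega), if_neg (by omega)]
      have hρ1 : ρ (2 * P + 1) = idx p q P (P + 1) (2 * P + 1) := if_pos rfl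
      have hρ2 : ρ (2 * P + 2) = Function.update (idx p q (P + 1) 0 (2 * P + 2)) o (2 * P + 1) := by
        simp [ρ]
      have hodd : ∀ i < P, ρ (2 * i + 1) = idx p q i (i + 1) (2 * i + 1) := fun i hi => by
        rw [hρ _ (by omega), alternatingRow_odd, if_neg (by omega)]
      have heven : ∀ i ≤ P, ρ (2 * i) = idx p q i i (2 * i) := fun i hi => by
        rw [hρ _ (by omega), alternatingRow_even]
      have hcases : ∀ h : ℕ, h < 2 * P + 3 →
          (∃ i < P, h = 2 * i + 1 ∧ ρ h = idx p q i (i + 1) (2 * i + 1)) ∨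
          (∃ i ≤ P, h = 2 * i ∧ ρ h = idx p q i i (2 * i)) ∨
          (h = 2 * P + 1 ∧ ρ h = idx p q P (P + 1) (2 * P + 1)) ∨
          (h = 2 * P + 2 ∧
            ρ h = Function.update (idx p q (P + 1) 0 (2 * P + 2)) o (2 * P + 1)) := by
        intro h hh
        rcases Nat.even_or_odd' h with ⟨i, rfl | rfl⟩
        · by_cases hi : i ≤ P
          · exact Or.inr (Or.inl ⟨i, hi, rfl, heven i hi⟩)
          · obtain rfl : i = P + 1 := by omega
            exact Or.inr (Or.inr (Or.inr ⟨rfl, hρ2⟩))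
        · by_cases hi : i < P
          · exact Or.inl ⟨i, hi, rfl, hodd i hi⟩
          · obtain rfl : i = P := by omega
            exact Or.inr (Or.inr (Or.inl ⟨rfl, hρ1⟩))
      obtain ⟨h1, h2⟩ := hrows ρ (2 * P + 3)
        (by
          intro h hh j
          rcases hcases h hh with ⟨i, hi, -, hr⟩ | ⟨i, hi, -, hr⟩ | ⟨-, hr⟩ | ⟨-, hr⟩ <;> rw [hr]
          · exact idx_lt (by omega) (by omega) (by omega) j
          · exact idx_lt (by omega) (by omega) (by omega) j
          · exact idx_lt (by omega) (by omega) (by omega) j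
          · rw [Function.update_apply]
            split_ifs
            · omega
            · exact idx_lt (by omega) (by omega) (by omega) j)
        (by
          intro h hh h' hh' hne c c' hc hc'
          rcases hcases h hh with ⟨i, hi, he, hr⟩ | ⟨i, hi, he, hr⟩ | ⟨he, hr⟩ | ⟨he, hr⟩ <;>
          rcases hcases h' hh' with
            ⟨i', hi', he', hr'⟩ | ⟨i', hi', he', hr'⟩ | ⟨he', hr'⟩ | ⟨he', hr'⟩ <;>
          simp only [hr, hr', idx, Function.update_apply] at hc hc' <;> clear hcases <;> grind)
      refine hasClosedWalk_of_pullback h1 (hasClosedWalk_alternating_third (P := P) hpq hop hoq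
        (fun i hi => ?_) (fun i hi => ?_) ?_ ?_)
      · have := h2 (2 * i) (by omega)
        rwa [heven i hi] at this
      · have := h2 (2 * i + 1) (by omega)
        rwa [hodd i hi] at this
      · have := h2 (2 * P + 1) (by omega)
        rwa [hρ1] at this
      · have := h2 (2 * P + 2) (by omega)
        rwa [hρ2] at this

/-! ### Two functions of one coordinate each -/

open Tag

/-- In an alternating walk `f'` extends the even edges and `f` the odd ones. Rows of equal parity
disagree everywhere, so spreadness relative to `∅` separates their values; across parities, `f` may
be evaluated on the even row with the same `p`-index, where either `f ≠ f'` or spreadness applies.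
-/
theorem hasConfigurations_of_two_coordinates {s l : ℕ} (hs : 2 ≤ s) (hl : 1 ≤ l) {θ : ℝ}
    (hθ : 0 < θ) : ∃ η : ℝ, 0 < η ∧
    ∃ N : ℕ, ∀ (V : Type*) [Fintype V] [DecidableEq V], N ≤ Fintype.card V →
      ∀ H : Finset (Finset V), IsRGraph (s + 1) H → IsFull (l + 1) H → ∀ D : Finset (Fin s → V),
      θ * (Fintype.card V : ℝ) ^ s ≤ D.card → (∀ S ∈ D, Function.Injective S) →
      ∀ (f f' : (Fin s → V) → V) (p p' : Fin s),
      (∀ S ∈ D, (∀ j, f S ≠ S j) ∧ insert (f S) (Finset.univ.image S) ∈ H) →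
      (∀ S ∈ D, (∀ j, f' S ≠ S j) ∧ insert (f' S) (Finset.univ.image S) ∈ H) →
      (∀ S ∈ D, f S ≠ f' S) → (∀ S ∈ D, ∀ S' ∈ D, S p = S' p → f S = f S') →
      (∀ S ∈ D, ∀ S' ∈ D, S p' = S' p' → f' S = f' S') →
      Spread D f ∅ η → Spread D f' ∅ η → HasConfigurations H l := by
  obtain ⟨η, hη, N, hbox⟩ := exists_separated_box s (2 * l + 20) (by omega) hθ (Fin 3)
  refine ⟨η, hη, N, fun V _ _ hV H hH hfull D hD hinj f f' p p' hf hf' hff' hfp hfp' hsp hsp' => ?_⟩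
  obtain ⟨q, hpq, hq⟩ : ∃ q : Fin s, p ≠ q ∧ (p' = p ∨ p' = q) := by
    by_cases h : p' = p
    · have : Nontrivial (Fin s) := Fin.nontrivial_iff_two_le.2 hs
      obtain ⟨q, hq⟩ := exists_ne p
      exact ⟨q, hq.symm, Or.inl h⟩
    · exact ⟨p', fun h' => h h'.symm, Or.inr rfl⟩
  have hww : ∀ S : Fin s → V, ∃ w : V, S ∈ D → (∀ j, w ≠ S j) ∧ (2 ≤ l → w ≠ f S ∧ w ≠ f' S ∧
      insert w ((insert (f S) (Finset.univ.image S)).erase (S p)) ∈ H) := by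
    intro S
    by_cases hS : S ∈ D
    · obtain ⟨hfS, hfH⟩ := hf S hS
      by_cases hl2 : 2 ≤ l
      · obtain ⟨w, hw, hwH, hwf⟩ := hfull.exists_replacement hH hfH (v := S p) (B := {f' S})
          (by simp) (by simp; omega)
        simp only [Finset.mem_insert, Finset.mem_image, Finset.mem_univ, true_and, not_or,
          not_exists, Finset.mem_singleton] at hw hwf
        exact ⟨w, fun _ => ⟨fun j h => hw.2 j h.symm, fun _ => ⟨hw.1, hwf, hwH⟩⟩⟩
      · exact ⟨f S, fun _ => ⟨hfS, fun h => absurd h hl2⟩⟩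
    · exact ⟨f S, fun h => absurd h hS⟩
  choose w hww using hww
  obtain ⟨x, hx, hxinj, hxF, hsep⟩ := hbox V hV D hD hinj ![f, f', w] (by
    intro c S hS
    fin_cases c
    · exact (hf S hS).1
    · exact (hf' S hS).1
    · exact (hww S hS).1)
  have hdisj : ∀ (c : Fin 3) (ι ι' : Fin s → ℕ), (∀ j, ι j < 2 * l + 20) →
      (∀ j, ι' j < 2 * l + 20) → (∀ j, ι j ≠ ι' j) →
      (![f, f', w] : Fin 3 → (Fin s → V) → V) c (row x ι) ≠ f (row x ι') ∧
      (![f, f', w] : Fin 3 → (Fin s → V) → V) c (row x ι) ≠ f' (row x ι') := by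
    intro c ι ι' hι hι' hne
    exact ⟨hsep c 0 ∅ ι ι' hι hι' (by simpa using hne) hsp,
      hsep c 1 ∅ ι ι' hι hι' (by simpa using hne) hsp'⟩
  have hfrow : ∀ ι ι' : Fin s → ℕ, (∀ j, ι j < 2 * l + 20) → (∀ j, ι' j < 2 * l + 20) →
      ι p = ι' p → f (row x ι) = f (row x ι') := fun ι ι' hι hι' h =>
    hfp _ (hx _ hι) _ (hx _ hι') (by simp [row, h])
  have hfrow' : ∀ ι ι' : Fin s → ℕ, (∀ j, ι j < 2 * l + 20) → (∀ j, ι' j < 2 * l + 20) →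
      ι p' = ι' p' → f' (row x ι) = f' (row x ι') := fun ι ι' hι hι' h =>
    hfp' _ (hx _ hι) _ (hx _ hι') (by simp [row, h])
  let e : ℕ → ℕ → V := fun P h => if h = 2 * P + 2 then w (row x (alternatingRow p q P (2 * P + 1)))
    else if h % 2 = 0 then f' (row x (alternatingRow p q P h))
    else f (row x (alternatingRow p q P h))
  have he0 : ∀ P i, i ≤ P → e P (2 * i) = f' (row x (alternatingRow p q P (2 * i))) := by
    intro P i hi
    simp only [e]
    rw [if_neg (by omega), if_pos (by omega)]
  have he1 : ∀ P i, i ≤ P → e P (2 * i + 1) = f (row x (alternatingRow p q P (2 * i + 1))) := by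
    intro P i hi
    simp only [e]
    rw [if_neg (by omega), if_neg (by omega)]
  have he2 : ∀ P, e P (2 * P + 2) = w (row x (alternatingRow p q P (2 * P + 1))) := fun P =>
    if_pos rfl
  have hlow : ∀ P ≤ l + 1, ∀ h < 2 * P + 2, ∀ j, alternatingRow p q P h j < 2 * l + 20 :=
    fun P hP h hh => alternatingRow_lt (by omega) hh
  have hfeq : ∀ P ≤ l + 1, ∀ i ≤ P, f (row x (alternatingRow p q P (2 * i + 1))) =
      f (row x (alternatingRow p q P (2 * i))) := by
    intro P hP i hi
    refine hfrow _ _ (hlow P hP _ (by omega)) (hlow P hP _ (by omega)) ?_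
    rw [alternatingRow_even, alternatingRow_odd, idx_left, idx_left]
  have hee : ∀ P ≤ l + 1, ∀ i ≤ P, ∀ i' ≤ P, e P (2 * i) ≠ e P (2 * i' + 1) := by
    intro P hP i hi i' hi'
    rw [he0 P i hi, he1 P i' hi', hfeq P hP i' hi']
    by_cases hii : i = i'
    · subst hii
      exact (hff' _ (hx _ (hlow P hP _ (by omega)))).symm
    · exact (hdisj 1 _ _ (hlow P hP _ (by omega)) (hlow P hP _ (by omega))
        fun j => alternatingRow_ne (b := 0) hii (by omega) j).1
  have hcases : ∀ P h : ℕ, h < 2 * P + 2 → (∃ i ≤ P, h = 2 * i) ∨ ∃ i ≤ P, h = 2 * i + 1 := by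
    intro P h hh
    rcases Nat.even_or_odd' h with ⟨i, rfl | rfl⟩
    · exact Or.inl ⟨i, by omega, rfl⟩
    · exact Or.inr ⟨i, by omega, rfl⟩
  have heinj : ∀ P ≤ l + 1, ∀ h < 2 * P + 2, ∀ h' < 2 * P + 2, e P h = e P h' → h = h' := by
    intro P hP h hh h' hh' hhh
    rcases hcases P h hh with ⟨i, hi, rfl⟩ | ⟨i, hi, rfl⟩ <;>
    rcases hcases P h' hh' with ⟨i', hi', rfl⟩ | ⟨i', hi', rfl⟩
    · by_contra hne
      rw [he0 P i hi, he0 P i' hi'] at hhh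
      exact (hdisj 1 _ _ (hlow P hP _ (by omega)) (hlow P hP _ (by omega))
        fun j => alternatingRow_ne (b := 0) (by omega) (by omega) j).2 hhh
    · exact absurd hhh (hee P hP i hi i' hi')
    · exact absurd hhh.symm (hee P hP i' hi' i hi)
    · by_contra hne
      rw [he1 P i hi, he1 P i' hi'] at hhh
      exact (hdisj 0 _ _ (hlow P hP _ (by omega)) (hlow P hP _ (by omega))
        fun j => alternatingRow_ne (b := 1) (by omega) (by omega) j).1 hhh
  have hxe : ∀ P ≤ l + 1, ∀ h < 2 * P + 2, ∀ j i, i < 2 * l + 20 → e P h ≠ x j i := by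
    intro P hP h hh j i hi
    rcases hcases P h hh with ⟨i', hi', rfl⟩ | ⟨i', hi', rfl⟩
    · rw [he0 P i' hi']
      exact hxF 1 _ (hlow P hP _ (by omega)) j i hi
    · rw [he1 P i' hi']
      exact hxF 0 _ (hlow P hP _ (by omega)) j i hi
  have hG : ∀ P ≤ l + 1, ∀ W : Set ℕ, ∀ h < 2 * P + 2, h ∈ W → rowEdge (alternatingRow p q P h) h ∈
      pullback H x (e P) (2 * l + 20) W := by
    intro P hP W h hh hW
    refine rowEdge_mem_pullback (hlow P hP h hh) hW ?_
    rcases hcases P h hh with ⟨i, hi, rfl⟩ | ⟨i, hi, rfl⟩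
    · rw [he0 P i hi]
      exact (hf' _ (hx _ (hlow P hP _ hh))).2
    · rw [he1 P i hi]
      exact (hf _ (hx _ (hlow P hP _ hh))).2
  have hev : ∀ P ≤ l + 1, Set.InjOn (interp x (e P)) (support s (2 * l + 20) {h | h < 2 * P + 2}) :=
    fun P hP => interp_injOn hxinj (heinj P hP) (hxe P hP)
  have hA : ∀ P ≤ l + 1, ∀ W : Set ℕ, (∀ h < 2 * P + 2, h ∈ W) → ∀ i ≤ P,
      rowEdge (idx p q i i (2 * i)) (2 * i) ∈ pullback H x (e P) (2 * l + 20) W := by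
    intro P hP W hW i hi
    have := hG P hP W (2 * i) (by omega) (hW _ (by omega))
    rwa [alternatingRow_even] at this
  have hB : ∀ P ≤ l + 1, ∀ W : Set ℕ, (∀ h < 2 * P + 2, h ∈ W) → ∀ i < P,
      rowEdge (idx p q i (i + 1) (2 * i + 1)) (2 * i + 1) ∈
        pullback H x (e P) (2 * l + 20) W := by
    intro P hP W hW i hi
    have := hG P hP W (2 * i + 1) (by omega) (hW _ (by omega))
    rwa [alternatingRow_odd, if_neg (by omega)] at this
  refine ⟨?_, ?_, fun hl2 => ?_⟩
  · obtain ⟨U, hU, -⟩ := exists_alternating_walk (P := l + 1) hpq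
      (fun i hi => hA (l + 1) le_rfl {h | h < 2 * (l + 1) + 2} (fun _ h => h) i hi.le)
      (hB (l + 1) le_rfl _ fun _ h => h)
    exact hasWalk_of_pullback (hev (l + 1) le_rfl) ⟨_, _, _, hU⟩
  · refine hasClosedWalk_of_pullback (hev l (by omega)) (hasClosedWalk_alternating hpq
      (hA l (by omega) _ fun _ h => h) (hB l (by omega) _ fun _ h => h) ?_)
    have := hG l (by omega) {h | h < 2 * l + 2} (2 * l + 1) (by omega)
      (show 2 * l + 1 < 2 * l + 2 by omega)
    rwa [alternatingRow_odd, if_pos rfl] at this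
  · obtain ⟨P, rfl⟩ : ∃ P, l = P + 1 := ⟨l - 1, by omega⟩
    have hP : P ≤ P + 1 + 1 := by omega
    have hrow : alternatingRow p q P (2 * P + 1) = idx p q P 0 (2 * P + 1) := by
      rw [alternatingRow_odd, if_pos rfl]
    have hlast := hlow P hP (2 * P + 1) (by omega)
    obtain ⟨hwS, hw⟩ := hww _ (hx _ hlast)
    obtain ⟨hwf, hwf', hwH⟩ := hw hl2
    have hwe : ∀ h < 2 * P + 2, e P h ≠ w (row x (alternatingRow p q P (2 * P + 1))) := by
      intro h hh
      rcases hcases P h hh with ⟨i, hi, rfl⟩ | ⟨i, hi, rfl⟩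
      · rw [he0 P i hi]
        -- The row `(0, P)` disagrees everywhere with the closing row `(P, 0)`. When `i` is `0` or
        -- `P`, `f'` of the row `(i, i)` equals `f'` of one of these two rows, because `f'` sees
        -- only one coordinate.
        have hιlt : ∀ j, idx p q 0 P (2 * P) j < 2 * (P + 1) + 20 :=
          idx_lt (by omega) (by omega) (by omega)
        have hfar : w (row x (alternatingRow p q P (2 * P + 1))) ≠
            f' (row x (idx p q 0 P (2 * P))) := by
          refine (hdisj 2 _ _ hlast hιlt fun j => ?_).2
          rw [hrow]
          unfold idx
          grind
        by_cases hi0 : i = 0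
        · subst hi0
          rcases hq with hq | hq
          · rw [hfrow' _ _ (hlow P hP _ (by omega)) hιlt
              (by rw [hq, alternatingRow_even, idx_left, idx_left])]
            exact hfar.symm
          · rw [hfrow' _ _ (hlow P hP _ (by omega)) hlast
              (by rw [hq, hrow, alternatingRow_even, idx_right hpq, idx_right hpq])]
            exact hwf'.symm
        by_cases hiP : i = P
        · subst hiP
          rcases hq with hq | hq
          · rw [hfrow' _ _ (hlow i hP _ (by omega)) hlast
              (by rw [hq, hrow, alternatingRow_even, idx_left, idx_left])]
            exact hwf'.symm
          · rw [hfrow' _ _ (hlow i hP _ (by omega)) hιlt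
              (by rw [hq, alternatingRow_even, idx_right hpq, idx_right hpq])]
            exact hfar.symm
        refine ((hdisj 2 _ _ hlast (hlow P hP _ (by omega)) fun j => ?_).2).symm
        rw [hrow, alternatingRow_even]
        unfold idx
        grind
      · rw [he1 P i hi]
        by_cases hiP : i = P
        · subst hiP
          exact hwf.symm
        · exact ((hdisj 2 _ _ hlast (hlow P hP _ (by omega)) fun j =>
            alternatingRow_ne (b := 1) (Ne.symm hiP) (by omega) j).1).symm
    have hsplit : ∀ h : ℕ, h < 2 * P + 3 → h < 2 * P + 2 ∨ h = 2 * P + 2 := fun h hh => by omega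
    have hev' : Set.InjOn (interp x (e P)) (support s (2 * (P + 1) + 20) {h | h < 2 * P + 3}) := by
      refine interp_injOn hxinj (fun h hh h' hh' hhh => ?_) fun h hh j i hi => ?_
      · rcases hsplit h hh with hh | rfl <;> rcases hsplit h' hh' with hh' | rfl
        · exact heinj P hP h hh h' hh' hhh
        · exact absurd (hhh.trans (he2 P)) (hwe h hh)
        · exact absurd (hhh.symm.trans (he2 P)) (hwe h' hh')
        · rfl
      · rcases hsplit h hh with hh | rfl
        · exact hxe P hP h hh j i hi
        · rw [he2]
          exact hxF 2 _ hlast j i hi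
    have hlt : ∀ h : ℕ, h < 2 * P + 2 → h ∈ {h | h < 2 * P + 3} := fun h hh =>
      show h < 2 * P + 3 by omega
    refine hasClosedWalk_of_pullback hev' (hasClosedWalk_alternating_refill (P := P) hpq
      (hA P hP _ hlt) (hB P hP _ hlt) ?_ ?_)
    · have hι : ∀ j, idx p q P (P + 1) (2 * P + 2) j < 2 * (P + 1) + 20 :=
        idx_lt (by omega) (by omega) (by omega)
      refine rowEdge_mem_pullback hι (hlt _ (by omega)) ?_
      rw [he1 P P le_rfl, hfrow _ _ hlast hι (by rw [hrow, idx_left, idx_left])]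
      exact (hf _ (hx _ hι)).2
    · rw [← hrow]
      refine insert_erase_mem_pullback hev' hlast (hlt _ (by omega))
        (show 2 * P + 2 < 2 * P + 3 by omega) (by rw [hrow, idx_left]) ?_
      rw [he2, he1 P P le_rfl]
      exact hwH

/-! ### Reduction of a dense shadow to the four cases -/

/-- Functions `f 0, …, f l` giving distinct extensions of every tuple of `D` to an edge of `H`. -/
structure IsExtensionSystem {V : Type*} [DecidableEq V] {s l : ℕ} (H : Finset (Finset V))
    (D : Finset (Fin s → V)) (f : Fin (l + 1) → (Fin s → V) → V) : Prop where
  injective : ∀ S ∈ D, Function.Injective S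
  distinct : ∀ S ∈ D, Function.Injective fun c => f c S
  extends_row : ∀ c, ∀ S ∈ D, (∀ j, f c S ≠ S j) ∧ insert (f c S) (Finset.univ.image S) ∈ H

theorem IsExtensionSystem.mono {V : Type*} [DecidableEq V] {s l : ℕ} {H : Finset (Finset V)}
    {D D' : Finset (Fin s → V)} {f : Fin (l + 1) → (Fin s → V) → V}
    (h : IsExtensionSystem H D f) (hD : D' ⊆ D) : IsExtensionSystem H D' f :=
  ⟨fun S hS => h.injective S (hD hS), fun S hS => h.distinct S (hD hS),
    fun c S hS => h.extends_row c S (hD hS)⟩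

/-- A function which is not spread on `J` agrees with a function of the coordinates in `J` on a
dense subfamily. -/
theorem exists_dense_of_not_spread {V : Type*} [Fintype V] [DecidableEq V] {s : ℕ}
    {D : Finset (Fin s → V)} {f : (Fin s → V) → V} {J : Finset (Fin s)} {η : ℝ}
    (h : ¬ Spread D f J η) : ∃ D' ⊆ D, η * (Fintype.card V : ℝ) ^ s ≤ D'.card ∧
      ∀ S ∈ D', ∀ S' ∈ D', (∀ j ∈ J, S j = S' j) → f S = f S' := by
  unfold Spread at h
  push Not at h
  obtain ⟨g, hg, hcard⟩ := h
  refine ⟨_, Finset.filter_subset _ _, hcard.le, fun S hS S' hS' hSS' => ?_⟩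
  rw [(Finset.mem_filter.1 hS).2, (Finset.mem_filter.1 hS').2, hg S S' hSS']

/-- A nonconstant function that is not spread relative to some single coordinate becomes a function
of that coordinate on a dense subfamily. Doing this for at most two functions ends in one of the
four cases. The final `η` is chosen after the densities of these subfamilies. -/
theorem hasConfigurations_of_constant_or_spread {s l : ℕ} (hs : 2 ≤ s) (hl : 1 ≤ l) {θ : ℝ}
    (hθ : 0 < θ) : ∃ η : ℝ, 0 < η ∧
    ∃ N : ℕ, ∀ (V : Type*) [Fintype V] [DecidableEq V], N ≤ Fintype.card V →
      ∀ H : Finset (Finset V), IsRGraph (s + 1) H → IsFull (l + 1) H → ∀ D : Finset (Fin s → V),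
      θ * (Fintype.card V : ℝ) ^ s ≤ D.card → ∀ f : Fin (l + 1) → (Fin s → V) → V,
      IsExtensionSystem H D f →
      (∀ c, (∀ S ∈ D, ∀ S' ∈ D, f c S = f c S') ∨ Spread D (f c) ∅ η) →
      HasConfigurations H l := by
  obtain ⟨η₁, hη₁, N₁, h₁⟩ := hasConfigurations_of_spread hs hl hθ
  obtain ⟨N₂, h₂⟩ := hasConfigurations_of_constants hs hl hθ
  obtain ⟨η₃, hη₃, N₃, h₃⟩ := hasConfigurations_of_constants_of_coordinate hs hl hη₁
  obtain ⟨η₄, hη₄, N₄, h₄⟩ := hasConfigurations_of_spread hs hl hη₁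
  obtain ⟨η₅, hη₅, N₅, h₅⟩ := hasConfigurations_of_two_coordinates hs hl hη₄
  refine ⟨min η₃ η₅, lt_min hη₃ hη₅, N₁ + N₂ + N₃ + N₄ + N₅ + 1,
    fun V _ _ hV H hH hfull D hD f hf hc => ?_⟩
  have hpos : (0 : ℝ) < Fintype.card V := by exact_mod_cast (by omega : 0 < Fintype.card V)
  have hne : ∀ {t : ℝ} {D' : Finset (Fin s → V)}, 0 < t →
      t * (Fintype.card V : ℝ) ^ s ≤ D'.card → D'.Nonempty := fun {t D'} ht h => by
    rw [← Finset.card_pos]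
    have : (0 : ℝ) < D'.card := lt_of_lt_of_le (by positivity) h
    exact_mod_cast this
  by_cases hall : ∀ c, ∀ S ∈ D, ∀ S' ∈ D, f c S = f c S'
  · obtain ⟨S₀, hS₀⟩ := hne hθ hD
    refine h₂ V (by omega) H D hD hf.injective (fun c => f c S₀) (hf.distinct S₀ hS₀)
      fun c S hS => ?_
    rw [hall c S₀ hS₀ S hS]
    exact hf.extends_row c S hS
  push Not at hall
  obtain ⟨c₁, hc₁⟩ := hall
  have hsp₁ := (hc c₁).resolve_left (by push Not; exact hc₁)
  by_cases hfree : ∀ j, Spread D (f c₁) {j} η₁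
  · exact h₁ V (by omega) H hH hfull D hD hf.injective (f c₁) (hf.extends_row c₁) hfree
  push Not at hfree
  obtain ⟨p, hp⟩ := hfree
  obtain ⟨D₁, hD₁, hD₁c, hcoord⟩ := exists_dense_of_not_spread hp
  have hf₁ := hf.mono hD₁
  have hcoord₁ : ∀ S ∈ D₁, ∀ S' ∈ D₁, S p = S' p → f c₁ S = f c₁ S' := fun S hS S' hS' h =>
    hcoord S hS S' hS' (by simpa using h)
  by_cases hothers : ∀ c, c ≠ c₁ → ∀ S ∈ D, ∀ S' ∈ D, f c S = f c S'
  · obtain ⟨S₀, hS₀⟩ := hne hη₁ hD₁c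
    have hconst : ∀ c : Fin l, ∀ S ∈ D₁, f (c₁.succAbove c) S₀ = f (c₁.succAbove c) S :=
      fun c S hS => hothers _ (Fin.succAbove_ne c₁ c) _ (hD₁ hS₀) _ (hD₁ hS)
    refine h₃ V (by omega) H D₁ hD₁c hf₁.injective (fun c => f (c₁.succAbove c) S₀)
      ((hf₁.distinct S₀ hS₀).comp Fin.succAbove_right_injective) (fun c S hS => ?_) (f c₁) p
      (hf₁.extends_row c₁) (fun c S hS => ?_) hcoord₁
      (hsp₁.anti hD₁ subset_rfl (min_le_left _ _))
    · rw [hconst c S hS]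
      exact hf₁.extends_row _ S hS
    · rw [hconst c S hS]
      exact fun h => Fin.succAbove_ne c₁ c (hf₁.distinct S hS h)
  push Not at hothers
  obtain ⟨c₂, hc₂₁, hc₂⟩ := hothers
  have hsp₂ := (hc c₂).resolve_left (by push Not; exact hc₂)
  by_cases hfree : ∀ j, Spread D₁ (f c₂) {j} η₄
  · exact h₄ V (by omega) H hH hfull D₁ hD₁c hf₁.injective (f c₂) (hf₁.extends_row c₂) hfree
  push Not at hfree
  obtain ⟨p', hp'⟩ := hfree
  obtain ⟨D₂, hD₂, hD₂c, hcoord'⟩ := exists_dense_of_not_spread hp'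
  have hf₂ := hf₁.mono hD₂
  exact h₅ V (by omega) H hH hfull D₂ hD₂c hf₂.injective (f c₁) (f c₂) p p' (hf₂.extends_row c₁)
    (hf₂.extends_row c₂) (fun S hS h => hc₂₁ (hf₂.distinct S hS h).symm)
    (fun S hS S' hS' h => hcoord₁ S (hD₂ hS) S' (hD₂ hS') h)
    (fun S hS S' hS' h => hcoord' S hS S' hS' (by simpa using h))
    (hsp₁.anti (hD₂.trans hD₁) subset_rfl (min_le_right _ _))
    (hsp₂.anti (hD₂.trans hD₁) subset_rfl (min_le_right _ _))

/-- Induction on the number of functions not yet known to be constant: one that is not spread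
relative to `∅` is constant on a dense subfamily and joins `C`. -/
theorem hasConfigurations_of_isExtensionSystem {s l : ℕ} (hs : 2 ≤ s) (hl : 1 ≤ l) (k : ℕ) :
    ∀ {θ : ℝ}, 0 < θ →
    ∃ N : ℕ, ∀ (V : Type*) [Fintype V] [DecidableEq V], N ≤ Fintype.card V →
      ∀ H : Finset (Finset V), IsRGraph (s + 1) H → IsFull (l + 1) H → ∀ D : Finset (Fin s → V),
      θ * (Fintype.card V : ℝ) ^ s ≤ D.card → ∀ f : Fin (l + 1) → (Fin s → V) → V,
      IsExtensionSystem H D f → ∀ C : Finset (Fin (l + 1)), Cᶜ.card = k →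
      (∀ c ∈ C, ∀ S ∈ D, ∀ S' ∈ D, f c S = f c S') → HasConfigurations H l := by
  induction k with
  | zero =>
    intro θ hθ
    obtain ⟨η, hη, N, h⟩ := hasConfigurations_of_constant_or_spread hs hl hθ
    refine ⟨N, fun V _ _ hV H hH hfull D hD f hf C hC hconst =>
      h V hV H hH hfull D hD f hf fun c => Or.inl (hconst c ?_)⟩
    by_contra hc
    have : c ∈ Cᶜ := Finset.mem_compl.2 hc
    rw [Finset.card_eq_zero.1 hC] at this
    simp at this
  | succ k ih =>
    intro θ hθ
    obtain ⟨η, hη, N, h⟩ := hasConfigurations_of_constant_or_spread hs hl hθ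
    obtain ⟨N', h'⟩ := ih hη
    refine ⟨N + N', fun V _ _ hV H hH hfull D hD f hf C hC hconst => ?_⟩
    by_cases hsp : ∀ c, c ∉ C → Spread D (f c) ∅ η
    · refine h V (by omega) H hH hfull D hD f hf fun c => ?_
      by_cases hc : c ∈ C
      · exact Or.inl (hconst c hc)
      · exact Or.inr (hsp c hc)
    · push Not at hsp
      obtain ⟨c, hc, hsp⟩ := hsp
      obtain ⟨D', hD', hD'c, hconst'⟩ := exists_dense_of_not_spread hsp
      refine h' V (by omega) H hH hfull D' hD'c f (hf.mono hD') (insert c C) ?_ fun c' hc' => ?_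
      · rw [Finset.compl_insert, Finset.card_erase_of_mem (Finset.mem_compl.2 hc), hC]
        rfl
      · rcases Finset.mem_insert.1 hc' with rfl | hc'
        · exact fun S hS S' hS' => hconst' S hS S' hS' (by simp)
        · exact fun S hS S' hS' => hconst c' hc' S (hD' hS) S' (hD' hS')

theorem IsFull.exists_isExtensionSystem {V : Type*} [Fintype V] [DecidableEq V] {s l : ℕ}
    (hs : 2 ≤ s) {H : Finset (Finset V)} (hH : IsRGraph (s + 1) H) (hfull : IsFull (l + 1) H) :
    ∃ (D : Finset (Fin s → V)) (f : Fin (l + 1) → (Fin s → V) → V),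
      IsExtensionSystem H D f ∧ (∂ H).card ≤ D.card := by
  let D : Finset (Fin s → V) := Finset.univ.filter fun S =>
    Function.Injective S ∧ Finset.univ.image S ∈ ∂ H
  have hg : ∀ S : Fin s → V, ∃ g : Fin (l + 1) → V, S ∈ D → Function.Injective g ∧
      ∀ c, (∀ j, g c ≠ S j) ∧ insert (g c) (Finset.univ.image S) ∈ H := by
    intro S
    by_cases hS : S ∈ D
    · obtain ⟨-, hS'⟩ := (Finset.mem_filter.1 hS).2
      have h := hfull _ hS'
      rw [codegree_eq_card_extensions hH (card_of_mem_shadow hH hS'), ← Fintype.card_coe] at h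
      obtain ⟨g⟩ := Function.Embedding.nonempty_of_card_le
        ((Fintype.card_fin (l + 1)).trans_le h)
      refine ⟨fun c => g c, fun _ => ⟨fun c c' hcc => g.injective (Subtype.ext hcc), fun c => ?_⟩⟩
      have := (Finset.mem_filter.1 (g c).2).2
      refine ⟨fun j hj => this.1 ?_, this.2⟩
      exact Finset.mem_image.2 ⟨j, Finset.mem_univ j, hj.symm⟩
    · exact ⟨fun _ => S ⟨0, by omega⟩, fun h => absurd h hS⟩
  choose g hg using hg
  refine ⟨D, fun c S => g S c, ⟨fun S hS => (Finset.mem_filter.1 hS).2.1, fun S hS => (hg S hS).1,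
    fun c S hS => (hg S hS).2 c⟩, ?_⟩
  have hsub : ∂ H ⊆ D.image fun S => Finset.univ.image S := by
    intro T hT
    let σ := Finset.equivFinOfCardEq (card_of_mem_shadow hH hT)
    have himage : (Finset.univ.image fun i => (σ.symm i : V)) = T := by
      ext v
      simp only [Finset.mem_image, Finset.mem_univ, true_and]
      constructor
      · rintro ⟨i, rfl⟩
        exact (σ.symm i).2
      · intro hv
        exact ⟨σ ⟨v, hv⟩, by simp⟩
    refine Finset.mem_image.2 ⟨fun i => σ.symm i, Finset.mem_filter.2 ⟨Finset.mem_univ _, ?_, ?_⟩,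
      himage⟩
    · exact Subtype.val_injective.comp σ.symm.injective
    · rw [himage]
      exact hT
  exact (Finset.card_le_card hsub).trans Finset.card_image_le

/-! ### Dense full hypergraphs contain the path and the cycle -/

/-- A dense `(l + 1)`-full hypergraph contains linear cycles and paths with `2 l + 1` or `2 l + 2`
edges. -/
theorem IsFull.containsCycle_and_containsPath {s l : ℕ} (hs : 2 ≤ s) (hl : 1 ≤ l) {ε : ℝ}
    (hε : 0 < ε) :
    ∃ N : ℕ, ∀ (V : Type*) [Fintype V] [DecidableEq V], N ≤ Fintype.card V →
      ∀ H : Finset (Finset V), IsRGraph (s + 1) H → IsFull (l + 1) H →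
      ε * (Fintype.card V : ℝ) ^ s < H.card → ∀ k, 4 ≤ k → (k = 2 * l + 1 ∨ k = 2 * l + 2) →
      ContainsCycle k H ∧ ContainsPath k H := by
  -- `K` bounds the number of vertices of any walk that the greedy construction has to avoid.
  set K : ℕ := (2 * l + 4) * (s + 1) with hK
  have hKpos : 0 < K := by positivity
  obtain ⟨N, hN⟩ := hasConfigurations_of_isExtensionSystem hs hl (l + 1)
    (θ := ε / K) (by positivity)
  refine ⟨N, fun V _ _ hV H hH hfull hcard k hk hkl => ?_⟩
  obtain ⟨F, hF, hFf, hFc⟩ := exists_isFull_subfamily K H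
  rcases F.eq_empty_or_nonempty with rfl | hne
  · rw [Finset.card_empty, zero_add] at hFc
    obtain ⟨D, f, hf, hD⟩ := hfull.exists_isExtensionSystem hs hH
    have hDc : ε / K * (Fintype.card V : ℝ) ^ s ≤ D.card := by
      rw [div_mul_eq_mul_div, div_le_iff₀ (by positivity)]
      have h1 : H.card ≤ K * D.card := hFc.trans (by gcongr)
      have h2 : (H.card : ℝ) ≤ K * D.card := by exact_mod_cast h1
      linarith
    obtain ⟨h1, h2, h3⟩ := hN V hV H hH hfull D hDc f hf ∅ (by simp) (by simp)
    refine ⟨containsCycle_of_hasClosedWalk hk ?_, containsPath_of_hasWalk (h1.mono (by omega))⟩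
    rcases hkl with rfl | rfl
    · exact h3 (by omega)
    · exact h2
  · have hFr : IsRGraph (s + 1) F := fun e he => hH (hF he)
    have hclosed : ∀ n, n ≤ 2 * l + 2 → HasClosedWalk (H : Set (Finset V)) (n + 2) := by
      intro n hn
      refine (hFf.hasClosedWalk hs hFr hne n ?_).superset (Finset.coe_subset.2 hF)
      rw [hK, Nat.lt_succ_iff]
      exact Nat.mul_le_mul_right _ (by omega)
    obtain ⟨n, rfl⟩ : ∃ n, k = n + 2 := ⟨k - 2, by omega⟩
    exact ⟨containsCycle_of_hasClosedWalk hk (hclosed n (by omega)),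
      containsPath_of_hasClosedWalk (hclosed (n + 1) (by omega))⟩

/-! ### The lower bound construction and the asymptotics -/

theorem ContainsCycle.mono {V : Type*} [DecidableEq V] {k : ℕ} {F H : Finset (Finset V)}
    (h : ContainsCycle k F) (hF : F ⊆ H) : ContainsCycle k H := by
  obtain ⟨e, he, hc⟩ := h
  exact ⟨e, fun i => hF (he i), hc⟩

theorem ContainsPath.mono {V : Type*} [DecidableEq V] {k : ℕ} {F H : Finset (Finset V)}
    (h : ContainsPath k F) (hF : F ⊆ H) : ContainsPath k H := by
  obtain ⟨e, he, hc⟩ := h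
  exact ⟨e, fun i => hF (he i), hc⟩

/-- Pigeonhole: more than `2 |L|` edges, each assigned a vertex of `L`, put three on one vertex. In
a linear path or cycle no vertex lies in three edges. -/
theorem exists_three_of_transversal {V ι : Type*} [DecidableEq V] [Fintype ι] [DecidableEq ι]
    {L : Finset V} {e : ι → Finset V} (he : ∀ i, (e i ∩ L).Nonempty)
    (hL : 2 * L.card < Fintype.card ι) :
    ∃ v i j m, i ≠ j ∧ i ≠ m ∧ j ≠ m ∧ v ∈ e i ∧ v ∈ e j ∧ v ∈ e m := by
  choose v hv using he
  obtain ⟨y, -, hy⟩ := Finset.exists_lt_card_fiber_of_mul_lt_card_of_maps_to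
    (s := Finset.univ) (t := L) (f := v) (n := 2)
    (fun i _ => (Finset.mem_inter.1 (hv i)).2) (by rw [Finset.card_univ]; omega)
  obtain ⟨i, j, m, hi, hj, hm, hij, him, hjm⟩ := Finset.two_lt_card_iff.1 hy
  have hmem : ∀ i ∈ Finset.univ.filter (fun i => v i = y), y ∈ e i := fun i hi => by
    rw [← (Finset.mem_filter.1 hi).2]
    exact (Finset.mem_inter.1 (hv i)).1
  exact ⟨y, i, j, m, hij, him, hjm, hmem i hi, hmem j hj, hmem m hm⟩

theorem not_containsPath_of_transversal {V : Type*} [DecidableEq V] {L : Finset V} {k : ℕ}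
    {H : Finset (Finset V)} (hH : ∀ e ∈ H, (e ∩ L).Nonempty) (hL : 2 * L.card < k) :
    ¬ ContainsPath k H := by
  rintro ⟨e, he, hp⟩
  obtain ⟨v, i, j, m, hij, him, hjm, hi, hj, hm⟩ :=
    exists_three_of_transversal (fun i => hH _ (he i)) (by rwa [Fintype.card_fin])
  have key : ∀ a b : Fin k, v ∈ e a → v ∈ e b → ¬ ((a : ℕ) + 1 < b) := fun a b ha hb hab =>
    Finset.disjoint_left.1 (hp.disjoint a b hab) ha hb
  have h1 := key i j hi hj
  have h2 := key j i hj hi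
  have h3 := key i m hi hm
  have h4 := key m i hm hi
  have h5 := key j m hj hm
  have h6 := key m j hm hj
  rw [Ne, Fin.ext_iff] at hij him hjm
  omega

theorem not_containsCycle_of_transversal {V : Type*} [DecidableEq V] {L : Finset V} {k : ℕ}
    (hk : 4 ≤ k) {H : Finset (Finset V)} (hH : ∀ e ∈ H, (e ∩ L).Nonempty)
    (hL : 2 * L.card < k) : ¬ ContainsCycle k H := by
  rintro ⟨e, he, hp⟩
  have : NeZero k := ⟨by omega⟩
  obtain ⟨v, i, j, m, hij, him, hjm, hi, hj, hm⟩ :=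
    exists_three_of_transversal (fun i => hH _ (he i)) (by rwa [ZMod.card])
  have key : ∀ a b, a ≠ b → v ∈ e a → v ∈ e b → b = a + 1 ∨ a = b + 1 := fun a b hab ha hb =>
    (hp.inter_nonempty_iff a b hab).1 ⟨v, Finset.mem_inter.2 ⟨ha, hb⟩⟩
  -- Three pairwise consecutive indices would force `3 = 0` modulo `k`, excluded by `4 ≤ k`.
  have h3 : ∀ a : ZMod k, a + 1 + 1 + 1 ≠ a := by
    intro a h
    have h0 : ((3 : ℕ) : ZMod k) = 0 := by
      push_cast
      linear_combination h
    have := Nat.le_of_dvd (by norm_num) ((ZMod.natCast_eq_zero_iff 3 k).1 h0)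
    omega
  rcases key i j hij hi hj with rfl | rfl <;> rcases key _ m him hi hm with h | h <;>
    rcases key _ m hjm hj hm with h' | h'
  · exact hjm h.symm
  · exact hjm h.symm
  · subst h'; exact h3 _ h.symm
  · exact him (add_right_cancel h')
  · subst h; exact him h'.symm
  · subst h; exact h3 _ h'.symm
  · exact hjm (add_right_cancel h)
  · exact hjm (add_right_cancel h)

theorem exists_transversal_family (s l n : ℕ) (hn : l ≤ n) :
    ∃ (L : Finset (Fin n)) (H : Finset (Finset (Fin n))), L.card = l ∧ IsRGraph (s + 1) H ∧
      (∀ e ∈ H, (e ∩ L).Nonempty) ∧ l * (n - l).choose s ≤ H.card := by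
  obtain ⟨L, -, hL⟩ := Finset.exists_subset_card_eq (s := (Finset.univ : Finset (Fin n)))
    (n := l) (by simpa using hn)
  refine ⟨L, (L ×ˢ Lᶜ.powersetCard s).image fun t => insert t.1 t.2, hL, ?_, ?_, ?_⟩
  · intro e he
    obtain ⟨⟨v, T⟩, ht, rfl⟩ := Finset.mem_image.1 he
    obtain ⟨hv, hT⟩ := Finset.mem_product.1 ht
    obtain ⟨hT, hTc⟩ := Finset.mem_powersetCard.1 hT
    rw [Finset.card_insert_of_notMem, hTc]
    exact fun h => Finset.mem_compl.1 (hT h) hv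
  · intro e he
    obtain ⟨⟨v, T⟩, ht, rfl⟩ := Finset.mem_image.1 he
    exact ⟨v, Finset.mem_inter.2 ⟨Finset.mem_insert_self _ _, (Finset.mem_product.1 ht).1⟩⟩
  · rw [Finset.card_image_of_injOn, Finset.card_product, Finset.card_powersetCard,
      Finset.card_compl, Fintype.card_fin, hL]
    rintro ⟨v, T⟩ ht ⟨v', T'⟩ ht' h
    obtain ⟨hv, hT⟩ := Finset.mem_product.1 (Finset.mem_coe.1 ht)
    obtain ⟨hv', hT'⟩ := Finset.mem_product.1 (Finset.mem_coe.1 ht')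
    have hT := (Finset.mem_powersetCard.1 hT).1
    have hT' := (Finset.mem_powersetCard.1 hT').1
    have h : insert v T = insert v' T' := h
    have hvT : ∀ w ∈ L, w ∉ T := fun w hw hwT => Finset.mem_compl.1 (hT hwT) hw
    have hvT' : ∀ w ∈ L, w ∉ T' := fun w hw hwT => Finset.mem_compl.1 (hT' hwT) hw
    have hvv : v = v' := by
      have : v ∈ insert v' T' := h ▸ Finset.mem_insert_self v T
      exact (Finset.mem_insert.1 this).resolve_right (hvT' v hv)
    subst hvv
    rw [Prod.mk.injEq]
    refine ⟨rfl, ?_⟩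
    rw [← Finset.erase_insert (hvT v hv), h, Finset.erase_insert (hvT' v hv)]

theorem le_ex {r n : ℕ} {P : Finset (Finset (Fin n)) → Prop} {H : Finset (Finset (Fin n))}
    (hH : IsRGraph r H) (hP : ¬ P H) : H.card ≤ ex r n P := by
  classical
  unfold ex
  exact Finset.le_sup (f := Finset.card) (Finset.mem_filter.2 ⟨Finset.mem_univ _, hH, hP⟩)

theorem ex_le {r n B : ℕ} {P : Finset (Finset (Fin n)) → Prop}
    (h : ∀ H : Finset (Finset (Fin n)), IsRGraph r H → ¬ P H → H.card ≤ B) : ex r n P ≤ B := by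
  classical
  unfold ex
  exact Finset.sup_le fun H hH => h H (Finset.mem_filter.1 hH).2.1 (Finset.mem_filter.1 hH).2.2

theorem card_shadow_le {s n : ℕ} {H : Finset (Finset (Fin n))} (hH : IsRGraph (s + 1) H) :
    (∂ H).card ≤ n.choose s := by
  have : ∂ H ⊆ Finset.univ.powersetCard s := fun S hS =>
    Finset.mem_powersetCard.2 ⟨Finset.subset_univ _, card_of_mem_shadow hH hS⟩
  simpa using Finset.card_le_card this

/-- The shift by `l` does not affect the asymptotics, and `n ^ s` is at most a constant times
`n.choose s`, so the error term is absorbed. -/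
theorem isEquivalent_choose_of_bounds {s l : ℕ} (hl : 1 ≤ l) {u : ℕ → ℝ}
    (hlow : ∀ᶠ n in Filter.atTop, (l : ℝ) * ((n - l).choose s : ℝ) ≤ u n)
    (hup : ∀ ε : ℝ, 0 < ε → ∀ᶠ n : ℕ in Filter.atTop,
      u n ≤ (l : ℝ) * (n.choose s : ℝ) + ε * (n : ℝ) ^ s) :
    u ~[Filter.atTop] fun n : ℕ => (l : ℝ) * (n.choose s : ℝ) := by
  have hl' : (1 : ℝ) ≤ l := by exact_mod_cast hl
  have hshift : (fun n : ℕ => (l : ℝ) * ((n - l).choose s : ℝ)) ~[Filter.atTop]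
      fun n : ℕ => (l : ℝ) * (n.choose s : ℝ) := by
    refine Asymptotics.IsEquivalent.refl.mul ?_
    have h1 : (fun n : ℕ => ((n - l).choose s : ℝ)) ~[Filter.atTop]
        fun n : ℕ => (((n - l : ℕ) : ℝ) ^ s / s.factorial : ℝ) :=
      (isEquivalent_choose s).comp_tendsto (Filter.tendsto_sub_atTop_nat l)
    have h2 : (fun n : ℕ => ((n - l : ℕ) : ℝ)) ~[Filter.atTop] fun n : ℕ => (n : ℝ) := by
      have h3 : (fun n : ℕ => (n : ℝ) - l) =ᶠ[Filter.atTop] fun n : ℕ => ((n - l : ℕ) : ℝ) := by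
        filter_upwards [Filter.eventually_ge_atTop l] with n hn
        rw [Nat.cast_sub hn]
      refine Asymptotics.IsEquivalent.congr_left ?_ h3
      refine Asymptotics.IsEquivalent.refl.sub_isLittleO ?_
      exact Asymptotics.isLittleO_const_left.2 (Or.inr
        (tendsto_norm_atTop_atTop.comp tendsto_natCast_atTop_atTop))
    exact h1.trans (((h2.pow s).div Asymptotics.IsEquivalent.refl).trans
      (isEquivalent_choose s).symm)
  obtain ⟨B, hBpos, hB⟩ := (isTheta_choose s).2.exists_pos
  rw [Asymptotics.IsBigOWith] at hB
  refine Asymptotics.isLittleO_iff.2 fun c hc => ?_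
  have hlow' := Asymptotics.isLittleO_iff.1 hshift hc
  filter_upwards [hlow, hup (c / B) (by positivity), hB, hlow'] with n h1 h2 h3 h4
  have hchoose : (0 : ℝ) ≤ n.choose s := by positivity
  simp only [Pi.sub_apply, Real.norm_eq_abs] at h3 h4 ⊢
  rw [abs_of_nonneg (by positivity : (0 : ℝ) ≤ (n : ℝ) ^ s), abs_of_nonneg hchoose] at h3
  rw [abs_of_nonneg (by positivity : (0 : ℝ) ≤ (l : ℝ) * n.choose s)] at h4 ⊢
  rw [abs_le] at h4 ⊢
  constructor
  · linarith [h4.1]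
  · have h5 : c / B * (n : ℝ) ^ s ≤ c / B * (B * n.choose s) := by gcongr
    have h6 : c / B * (B * (n.choose s : ℝ)) = c * n.choose s := by field_simp
    have h7 : (n.choose s : ℝ) ≤ l * n.choose s := le_mul_of_one_le_left hchoose hl'
    have h8 : c * (n.choose s : ℝ) ≤ c * (l * n.choose s) := by gcongr
    linarith

theorem ex_isEquivalent {s l : ℕ} (hl : 1 ≤ l)
    {P : ∀ n : ℕ, Finset (Finset (Fin n)) → Prop}
    (hmono : ∀ n F H, F ⊆ H → P n F → P n H)
    (htransversal : ∀ n (L : Finset (Fin n)) H, (∀ e ∈ H, (e ∩ L).Nonempty) → L.card = l →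
      ¬ P n H)
    (hdense : ∀ ε : ℝ, 0 < ε → ∃ N : ℕ, ∀ n, N ≤ n → ∀ H : Finset (Finset (Fin n)),
      IsRGraph (s + 1) H → IsFull (l + 1) H → ε * (n : ℝ) ^ s < H.card → P n H) :
    (fun n : ℕ => (ex (s + 1) n (P n) : ℝ)) ~[Filter.atTop]
      fun n : ℕ => (l : ℝ) * (n.choose s : ℝ) := by
  refine isEquivalent_choose_of_bounds hl ?_ fun ε hε => ?_
  · filter_upwards [Filter.eventually_ge_atTop l] with n hn
    obtain ⟨L, H, hL, hH, hLH, hcard⟩ := exists_transversal_family s l n hn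
    exact_mod_cast hcard.trans (le_ex hH (htransversal n L H hLH hL))
  · obtain ⟨N, hN⟩ := hdense ε hε
    filter_upwards [Filter.eventually_ge_atTop N] with n hn
    have hnn : 0 ≤ ε * (n : ℝ) ^ s := by positivity
    have hex : ex (s + 1) n (P n) ≤ l * n.choose s + ⌊ε * (n : ℝ) ^ s⌋₊ := by
      refine ex_le fun H hH hP => ?_
      obtain ⟨F, hF, hFf, hFc⟩ := exists_isFull_subfamily l H
      have h1 : (F.card : ℝ) ≤ ε * (n : ℝ) ^ s := by
        by_contra hcon
        exact hP (hmono n F H hF (hN n hn F (fun e he => hH (hF he)) hFf (not_le.1 hcon)))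
      have h2 : F.card ≤ ⌊ε * (n : ℝ) ^ s⌋₊ := Nat.le_floor h1
      have h3 : l * (∂ H).card ≤ l * n.choose s := Nat.mul_le_mul_left _ (card_shadow_le hH)
      omega
    have h1 : (ex (s + 1) n (P n) : ℝ) ≤ l * n.choose s + (⌊ε * (n : ℝ) ^ s⌋₊ : ℕ) := by
      exact_mod_cast hex
    linarith [Nat.floor_le hnn]

end UniformHypergraph

theorem mainTheorem3 (r k : ℕ) (hr : 3 ≤ r) (hk : 4 ≤ k) :
    (∀ ε : ℝ, 0 < ε → ∃ N : ℕ, ∀ n : ℕ, N ≤ n →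
      ∀ (V : Type*) [Fintype V] [DecidableEq V], Fintype.card V = n →
      ∀ H : Finset (Finset V), UniformHypergraph.IsRGraph r H →
        UniformHypergraph.IsFull ((k - 1) / 2 + 1) H →
        (¬ UniformHypergraph.ContainsCycle k H ∨ ¬ UniformHypergraph.ContainsPath k H) →
        (H.card : ℝ) ≤ ε * (n : ℝ) ^ (r - 1)) ∧
    ((fun n : ℕ => (UniformHypergraph.ex r n (UniformHypergraph.ContainsPath k) : ℝ))
      ~[Filter.atTop] fun n : ℕ => (((k - 1) / 2 : ℕ) : ℝ) * (n.choose (r - 1) : ℝ)) ∧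
    ((fun n : ℕ => (UniformHypergraph.ex r n (UniformHypergraph.ContainsCycle k) : ℝ))
      ~[Filter.atTop] fun n : ℕ => (((k - 1) / 2 : ℕ) : ℝ) * (n.choose (r - 1) : ℝ)) := by
  obtain ⟨s, rfl⟩ : ∃ s, r = s + 1 := ⟨r - 1, by omega⟩
  obtain ⟨l, hl⟩ : ∃ l, l = (k - 1) / 2 := ⟨_, rfl⟩
  rw [← hl, Nat.add_sub_cancel]
  have hs : 2 ≤ s := by omega
  have hl1 : 1 ≤ l := by omega
  have hkl : k = 2 * l + 1 ∨ k = 2 * l + 2 := by omega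
  refine ⟨fun ε hε => ?_, ?_, ?_⟩
  · obtain ⟨N, hN⟩ := UniformHypergraph.IsFull.containsCycle_and_containsPath hs hl1 hε
    refine ⟨N, fun n hn V _ _ hV H hH hfull hfree => ?_⟩
    subst hV
    by_contra hcon
    obtain ⟨hcycle, hpath⟩ := hN V hn H hH hfull (not_le.1 hcon) k hk hkl
    exact hfree.elim (fun h => h hcycle) fun h => h hpath
  · refine UniformHypergraph.ex_isEquivalent hl1 (P := fun _ => UniformHypergraph.ContainsPath k)
      (fun _ _ _ hF h => h.mono hF)
      (fun n L H hLH hL => UniformHypergraph.not_containsPath_of_transversal hLH (by omega))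
      fun ε hε => ?_
    obtain ⟨N, hN⟩ := UniformHypergraph.IsFull.containsCycle_and_containsPath hs hl1 hε
    exact ⟨N, fun n hn H hH hfull hcard =>
      (hN (Fin n) (by simpa using hn) H hH hfull (by simpa using hcard) k hk hkl).2⟩
  · refine UniformHypergraph.ex_isEquivalent hl1
      (P := fun _ => UniformHypergraph.ContainsCycle k) (fun _ _ _ hF h => h.mono hF)
      (fun n L H hLH hL => UniformHypergraph.not_containsCycle_of_transversal hk hLH (by omega))
      fun ε hε => ?_
    obtain ⟨N, hN⟩ := UniformHypergraph.IsFull.containsCycle_and_containsPath hs hl1 hε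
    exact ⟨N, fun n hn H hH hfull hcard =>
      (hN (Fin n) (by simpa using hn) H hH hfull (by simpa using hcard) k hk hkl).1⟩
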